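/- Let $s\in\mathbb N=\{1,2,\dots\}$, $\mathbb N_0=\mathbb N\cup\{0\}$, $\mathbb N_*^s=\mathbb N_0^s\setminus\{\boldsymbol 0\}$. For $k\in\mathbb N_0$ with binary expansion $k=\sum_{\ell\ge1}a_\ell 2^{\ell-1}$, let $\kappa=\{\ell\in\mathbb N: a_\ell=1\}$, and let $\lceil\kappa\rceil_q$ be the $q$-th largest element of $\kappa$, with $\lceil\kappa\rceil_q=0$ if $q>|\kappa|$. For $\boldsymbol k\in\mathbb N_0^s$ put $\lceil\boldsymbol k\rceil_q=(\lceil\kappa_1\rceil_q,\dots,\lceil\kappa_s\rceil_q)$. For $x=\sum_{\ell\ge1}x_\ell2^{-\ell}\in[0,1)$ (the finite expansion is chosen if there are two) let $\mathrm{wal}_k(x)=(-1)^{\sum_{\ell\in\kappa}x_\ell}$. For $f\in C([0,1]^s)$ define the Walsh coefficients $$\hat f(\boldsymbol k)=\int_{[0,1]^s}f(\boldsymbol x)\prod_{j=1}^s\mathrm{wal}_{k_j}(x_j)\,\mathrm d\boldsymbol x .$$ For $0<\lambda\le1$ and $p\in(\lambda^{-1},\infty]$, a function $g:[0,1]^s\to\mathbb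 R$ belongs to $\mathcal H_{\lambda,s,p}$ if there are functions $D^\lambda_u g\in L^p([0,1]^{u})$, $u\subseteq\{1,\dots,s\}$ (a real number when $u=\emptyset$), such that for all $\boldsymbol x\in[0,1]^s$ $$g(\boldsymbol x)=\sum_{u\subseteq\{1,\dots,s\}}\Gamma(\lambda)^{-|u|}\int_{[0,1]^{u}}D^\lambda_u g(\boldsymbol t_u)\prod_{j\in u}(x_j-t_j)_+^{\lambda-1}\,\mathrm d\boldsymbol t_u ,$$ where $(x-t)_+^{\lambda-1}$ is $(x-t)^{\lambda-1}$ for $t<x$ and $0$ otherwise. The $D^\lambda_u g$ are called the $\lambda$-fractional derivatives of $g$. **Theorem.** Let $\alpha\in\mathbb N_0$, $0<\lambda\le1$ and $p\ge2$ with $p>\lambda^{-1}$. Let $f\in C([0,1]^s)$ be real-valued and such that the iterated partial derivative $$f^{(\alpha,\dots,\alpha)}=\frac{\partial^{\alpha s}f}{\partial x_1^\alpha\cdots\partial x_s^\alpha}$$ exists on $[0,1]^s$ (one-sided on the boundary) and belongs to $\mathcal H_{\lambda,s,p}$. For $\boldsymbol\ell\in\mathbb N^s$ let $B_{\alpha,\boldsymbol\ell,s}=\{\boldsymbol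 k\in\mathbb N_*^s:\lceil\boldsymbol k\rceil_{\alpha+1}=\boldsymbol\ell\}$ and $\|\boldsymbol\ell\|_1=\sum_{j}\ell_j$. Then $\sum_{\boldsymbol k\in B_{\alpha,\boldsymbol\ell,s}}|\hat f(\boldsymbol k)|^2$ converges, and $$\Bigl(\sum_{\boldsymbol k\in B_{\alpha,\boldsymbol\ell,s}}|\hat f(\boldsymbol k)|^2\Bigr)^{1/2}\le C_\lambda^s\,\bigl\|D^\lambda_{1:s}f^{(\alpha,\dots,\alpha)}\bigr\|_{L^2([0,1]^s)}\,2^{-(\alpha+\lambda)\|\boldsymbol\ell\|_1},$$ where $D^\lambda_{1:s}=D^\lambda_{\{1,\dots,s\}}$ and $$C_\lambda=\begin{cases}2\sqrt2\,\Gamma(\lambda+1)^{-1}&\text{if }0<\lambda<1,\\ \sqrt2&\text{if }\lambda=1.\end{cases}$$ -/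

import Mathlib

namespace WalshSobolev

open MeasureTheory

noncomputable section

/-- The closed unit cube `[0,1]^ι`. -/
def cube (ι : Type*) : Set (ι → ℝ) := Set.Icc 0 1

/-- The positions `ℓ ≥ 1` of the nonzero bits of `k = ∑_{ℓ ≥ 1} a_ℓ 2^(ℓ-1)`. -/
def nonzeroBits (k : ℕ) : Finset ℕ :=
  (Finset.Icc 1 k.size).filter (fun l => k.testBit (l - 1) = true)

/-- The `q`-th largest element of `κ` for `q ≥ 1`, with value `0` when `q` exceeds the cardinality
of `κ`. -/
def qthLargest (κ : Finset ℕ) (q : ℕ) : ℕ :=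
  (κ.sort (fun a b => a ≥ b)).getD (q - 1) 0

/-- The `l`-th binary digit (`l ≥ 1`) of `x ∈ [0,1)`; a dyadic rational gets its finite
expansion. -/
def binDigit (x : ℝ) (l : ℕ) : ℕ := ⌊(2 : ℝ) ^ l * x⌋₊ % 2

/-- The univariate Walsh function in base two. -/
def wal (k : ℕ) (x : ℝ) : ℝ := (-1) ^ (∑ l ∈ nonzeroBits k, binDigit x l)

/-- The Walsh coefficient of `f` at `k`. -/
def walshCoeff {s : ℕ} (f : (Fin s → ℝ) → ℝ) (k : Fin s → ℕ) : ℝ :=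
  ∫ x in cube (Fin s), f x * ∏ j, wal (k j) (x j)

/-- The set of nonzero frequencies `k` for which the `(α+1)`-st largest nonzero bit of `k_j` is at
position `ℓ_j`, for every `j`. -/
def block {s : ℕ} (α : ℕ) (l : Fin s → ℕ) : Set (Fin s → ℕ) :=
  {k | k ≠ 0 ∧ ∀ j, qthLargest (nonzeroBits (k j)) (α + 1) = l j}

/-- On the closed unit cube, `g` is the partial derivative of `f` in the variable `j` (one-sided on
the two faces `x_j = 0` and `x_j = 1`). -/
def IsPartialDeriv {s : ℕ} (j : Fin s) (f g : (Fin s → ℝ) → ℝ) : Prop :=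
  ∀ x ∈ cube (Fin s),
    HasDerivWithinAt (fun t : ℝ => f (Function.update x j t)) (g x) (Set.Icc 0 1) (x j)

/-- `g` is the iterated partial derivative of `f` on the unit cube in the listed variables, where
the last variable of the list is the first one to be differentiated. -/
def IsIterPartialDeriv {s : ℕ} :
    List (Fin s) → ((Fin s → ℝ) → ℝ) → ((Fin s → ℝ) → ℝ) → Prop
  | [], f, g => Set.EqOn f g (cube (Fin s))
  | j :: L, f, g => ∃ h : (Fin s → ℝ) → ℝ, IsIterPartialDeriv L f h ∧ IsPartialDeriv j h g

/-- `f^(a) = g` on the unit cube, where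
`f^(a) = ∂^{a_1 + ⋯ + a_s} f / (∂x_1^{a_1} ⋯ ∂x_s^{a_s})`. -/
def IsMixedDeriv {s : ℕ} (a : Fin s → ℕ) (f g : (Fin s → ℝ) → ℝ) : Prop :=
  IsIterPartialDeriv ((List.finRange s).flatMap (fun j => List.replicate (a j) j)) f g

/-- `(x - t)_+^(lam - 1)`, which vanishes for `t ≥ x` (also when `lam = 1`). -/
def fracKernel (lam x t : ℝ) : ℝ := if t < x then (x - t) ^ (lam - 1) else 0

/-- The functions `D u` on `[0,1]^u`, for `u ⊆ {1,…,s}`, are in `L^p` and are the fractional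
derivatives of order `lam` of `g`. For `0 < lam ≤ 1` and `p > 1 / lam`, the function `g` belongs to
the fractional Sobolev space of order `lam` and exponent `p` if and only if such a family exists. -/
def IsFracDeriv {s : ℕ} (lam : ℝ) (p : ENNReal) (g : (Fin s → ℝ) → ℝ)
    (D : ∀ u : Finset (Fin s), (u → ℝ) → ℝ) : Prop :=
  (∀ u : Finset (Fin s), MemLp (D u) p (volume.restrict (cube u))) ∧
  ∀ x ∈ cube (Fin s), g x = ∑ u : Finset (Fin s),
    ((Real.Gamma lam) ^ u.card)⁻¹ *
      ∫ t in cube u, D u t * ∏ j : u, fracKernel lam (x j) (t j)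

/-- The constant `C_lam`, for `0 < lam ≤ 1`. -/
def fracConst (lam : ℝ) : ℝ :=
  if lam < 1 then 2 * Real.sqrt 2 / Real.Gamma (lam + 1) else Real.sqrt 2

end

end WalshSobolev

namespace WalshSobolev

open MeasureTheory Set

/-! In each coordinate, split the nonzero bits of `k j` at the position `l j`: exactly `α` bits lie
above it (a set `T`) and an arbitrary set `S` lies below. The Walsh function is the product of the
Rademacher functions of `T`, of `l j` and of `S`.

Each bit of `T` pays for one classical derivative. Integrating finest scales first, the `α`-fold
primitive of the Walsh function is `φ * rad (l j) * ∏ m ∈ S, rad m` with `φ` periodic and `0 ≤ φ ≤ ∏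
m ∈ T, 2 ^ (-m)`, and all boundary terms vanish (`exists_iterate_primitive_prod_rad`). Integration
by parts therefore replaces `f` by its mixed derivative (`integral_mul_prod_of_isIterPartialDeriv`).

The bit `l j` pays for the fractional derivative. It gives the primitive mean zero, which removes
every `D u` except the one with all variables. Moving the fractional kernel onto the primitive gives
`∑ c, (∏ m ∈ S, rad m (c * 2 ^ (-n))) * K c t` with `n = l j - 1`, where `K` does not depend on `S`
(`exists_kernel`). For fixed `T` the coefficients are thus, up to sign and a power of `Gamma lam`,
the discrete Walsh transform of the numbers `∫ D * ∏ K`. Parseval (`sum_sq_discreteWalsh`) and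
Schur's test (`sum_sq_integral_prod_kernel_le`) bound their square sum; the row and column sums of
`K` are controlled by telescoping, because the truncated power is monotone away from its
singularity.

Finally, summing `∏ m ∈ T, 4 ^ (-m)` over all `T` costs a factor `2` per coordinate
(`sum_powersetCard_sq_prod_le`), the source of the `√2` in the constant. -/

/-- Lebesgue measure on the unit interval. -/
noncomputable abbrev unitMeasure : Measure ℝ := volume.restrict (Icc (0 : ℝ) 1)

instance : IsProbabilityMeasure unitMeasure := ⟨by simp [unitMeasure]⟩

/-- Lebesgue measure on the unit cube, as a product of measures on the unit interval. -/
noncomputable abbrev cubeMeasure (ι : Type*) [Fintype ι] : Measure (ι → ℝ) :=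
  Measure.pi (fun _ => unitMeasure)

/-! ### Product measure on the cube and bounded measurable functions. -/

section Cube

variable {ι : Type*}

theorem mem_cube {x : ι → ℝ} : x ∈ cube ι ↔ ∀ i, x i ∈ Icc (0 : ℝ) 1 := by
  simp only [cube, Set.mem_Icc, Pi.le_def, Pi.zero_apply, Pi.one_apply]
  exact ⟨fun h i => ⟨h.1 i, h.2 i⟩, fun h => ⟨fun i => (h i).1, fun i => (h i).2⟩⟩

theorem update_mem_cube [DecidableEq ι] {x : ι → ℝ} (hx : x ∈ cube ι) (j : ι) {t : ℝ}
    (ht : t ∈ Icc (0 : ℝ) 1) : Function.update x j t ∈ cube ι := by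
  rw [mem_cube] at *
  intro i
  by_cases h : i = j
  · subst h; simpa using ht
  · simpa [h] using hx i

theorem cube_eq_pi : cube ι = Set.pi univ (fun _ => Icc (0 : ℝ) 1) := by
  ext x; simp only [mem_cube, mem_univ_pi]


theorem measurableSet_cube [Fintype ι] : MeasurableSet (cube ι) := by
  rw [cube_eq_pi]; exact MeasurableSet.univ_pi fun _ => measurableSet_Icc

theorem volume_restrict_cube [Fintype ι] :
    (volume : Measure (ι → ℝ)).restrict (cube ι) = cubeMeasure ι := by
  rw [cube_eq_pi, volume_pi, Measure.restrict_pi_pi]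

theorem ae_mem_cube [Fintype ι] : ∀ᵐ x ∂cubeMeasure ι, x ∈ cube ι := by
  rw [← volume_restrict_cube]
  exact ae_restrict_mem measurableSet_cube

theorem ae_mem_unit : ∀ᵐ t ∂unitMeasure, t ∈ Icc (0 : ℝ) 1 := ae_restrict_mem measurableSet_Icc

theorem measurable_update_pair [DecidableEq ι] (j : ι) :
    Measurable (fun q : (ι → ℝ) × ℝ => Function.update q.1 j q.2) := by
  rw [measurable_pi_iff]
  intro i
  by_cases h : i = j
  · subst h; simpa using measurable_snd
  · simp only [Function.update_of_ne h]
    exact (measurable_pi_apply i).comp measurable_fst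

/-- The overwritten coordinate integrates to total mass one and the fresh one takes its place. This
gives Fubini in one coordinate without splitting the index type. -/
theorem measurePreserving_update_pair [Fintype ι] [DecidableEq ι] (j : ι) :
    MeasurePreserving (fun q : (ι → ℝ) × ℝ => Function.update q.1 j q.2)
      ((cubeMeasure ι).prod unitMeasure) (cubeMeasure ι) := by
  refine ⟨measurable_update_pair j, (Measure.pi_eq fun s hs => ?_).symm⟩
  rw [Measure.map_apply (measurable_update_pair j) (MeasurableSet.univ_pi hs)]
  have : (fun q : (ι → ℝ) × ℝ => Function.update q.1 j q.2) ⁻¹' (Set.pi univ s) =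
      (Set.pi univ (Function.update s j univ)) ×ˢ (s j) := by
    ext ⟨x, t⟩
    simp only [mem_preimage, mem_univ_pi, mem_prod]
    constructor
    · intro h
      refine ⟨fun i => ?_, by simpa using h j⟩
      by_cases hi : i = j
      · subst hi; simp
      · simpa [hi] using h i
    · rintro ⟨h, ht⟩ i
      by_cases hi : i = j
      · subst hi; simpa using ht
      · simpa [hi] using h i
  rw [this, Measure.prod_prod, Measure.pi_pi, ← Finset.prod_erase_mul _ _ (Finset.mem_univ j),
    ← Finset.prod_erase_mul (Finset.univ) (fun i => unitMeasure (s i)) (Finset.mem_univ j)]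
  simp only [Function.update_self, measure_univ, mul_one]
  congr 1
  exact Finset.prod_congr rfl fun i hi => by rw [Function.update_of_ne (Finset.ne_of_mem_erase hi)]

/-- Integration over the cube may be preceded by integration in one of the coordinates. -/
theorem integral_cube_update [Fintype ι] [DecidableEq ι] (j : ι) {F : (ι → ℝ) → ℝ}
    (hF : Integrable F (cubeMeasure ι)) :
    ∫ x, F x ∂cubeMeasure ι =
      ∫ x, (∫ t in (0 : ℝ)..1, F (Function.update x j t)) ∂cubeMeasure ι := by
  have h := measurePreserving_update_pair j
  have h2 : Integrable (fun q : (ι → ℝ) × ℝ => F (Function.update q.1 j q.2))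
      ((cubeMeasure ι).prod unitMeasure) := h.integrable_comp_of_integrable hF
  calc ∫ x, F x ∂cubeMeasure ι
      = ∫ q, F (Function.update q.1 j q.2) ∂((cubeMeasure ι).prod unitMeasure) := by
        conv_lhs => rw [← h.map_eq]
        rw [integral_map h.measurable.aemeasurable]
        rw [h.map_eq]; exact hF.aestronglyMeasurable
    _ = _ := by
        rw [integral_prod _ h2]
        simp only [unitMeasure, intervalIntegral.integral_of_le zero_le_one,
          integral_Icc_eq_integral_Ioc]

theorem measurePreserving_restrict_cube [Fintype ι] [DecidableEq ι] (u : Finset ι) :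
    MeasurePreserving (fun (x : ι → ℝ) (j : u) => x j) (cubeMeasure ι) (cubeMeasure u) := by
  have hm : Measurable (fun (x : ι → ℝ) (j : u) => x j) :=
    measurable_pi_iff.2 fun j => measurable_pi_apply _
  refine ⟨hm, (Measure.pi_eq fun s hs => ?_).symm⟩
  rw [Measure.map_apply hm (MeasurableSet.univ_pi hs)]
  have : (fun (x : ι → ℝ) (j : u) => x j) ⁻¹' (Set.pi univ s) =
      Set.pi univ (fun i => if h : i ∈ u then s ⟨i, h⟩ else univ) := by
    ext x
    simp only [mem_preimage, mem_univ_pi]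
    constructor
    · intro h i
      by_cases hi : i ∈ u
      · simpa [hi] using h ⟨i, hi⟩
      · simp [hi]
    · rintro h ⟨i, hi⟩
      simpa [hi] using h i
  rw [this, Measure.pi_pi, ← Finset.prod_subset (Finset.subset_univ u), ← Finset.prod_coe_sort u]
  · refine Finset.prod_congr rfl fun i _ => ?_
    simp
  · intro i _ hi
    simp [hi]

/-- Measurable functions that are bounded on the cube. -/
def BddMeas (f : (ι → ℝ) → ℝ) : Prop := Measurable f ∧ ∃ M, ∀ x ∈ cube ι, |f x| ≤ M

/-- Measurable functions that are bounded on the unit interval. -/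
def BddMeasUnit (w : ℝ → ℝ) : Prop := Measurable w ∧ ∃ M, ∀ t ∈ Icc (0 : ℝ) 1, |w t| ≤ M

theorem BddMeas.integrable [Fintype ι] {f : (ι → ℝ) → ℝ} (hf : BddMeas f) :
    Integrable f (cubeMeasure ι) := by
  obtain ⟨hm, M, hM⟩ := hf
  exact Integrable.of_bound hm.aestronglyMeasurable M
    (ae_mem_cube.mono fun x hx => by simpa using hM x hx)

theorem BddMeasUnit.integrable {w : ℝ → ℝ} (hf : BddMeasUnit w) : Integrable w unitMeasure := by
  obtain ⟨hm, M, hM⟩ := hf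
  exact Integrable.of_bound hm.aestronglyMeasurable M
    (ae_mem_unit.mono fun x hx => by simpa using hM x hx)

theorem BddMeasUnit.intervalIntegrable {w : ℝ → ℝ} (hf : BddMeasUnit w) {a b : ℝ}
    (ha : a ∈ Icc (0 : ℝ) 1) (hb : b ∈ Icc (0 : ℝ) 1) : IntervalIntegrable w volume a b := by
  have h : IntegrableOn w (Icc 0 1) := hf.integrable
  refine (h.mono_set ?_).intervalIntegrable
  exact uIcc_subset_Icc ha hb

theorem BddMeas.mul {f g : (ι → ℝ) → ℝ} (hf : BddMeas f) (hg : BddMeas g) :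
    BddMeas (fun x => f x * g x) := by
  obtain ⟨hm, M, hM⟩ := hf
  obtain ⟨hm', M', hM'⟩ := hg
  refine ⟨hm.mul hm', M * M', fun x hx => ?_⟩
  rw [abs_mul]
  exact mul_le_mul (hM x hx) (hM' x hx) (abs_nonneg _) ((abs_nonneg _).trans (hM x hx))

theorem BddMeas.sub {f g : (ι → ℝ) → ℝ} (hf : BddMeas f) (hg : BddMeas g) :
    BddMeas (fun x => f x - g x) := by
  obtain ⟨hm, M, hM⟩ := hf
  obtain ⟨hm', M', hM'⟩ := hg
  refine ⟨hm.sub hm', M + M', fun x hx => ?_⟩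
  exact (abs_sub _ _).trans (add_le_add (hM x hx) (hM' x hx))

theorem BddMeas.sum {κ : Type*} (s : Finset κ) {f : κ → (ι → ℝ) → ℝ}
    (hf : ∀ i ∈ s, BddMeas (f i)) : BddMeas (fun x => ∑ i ∈ s, f i x) := by
  have hb : ∀ i, ∃ M, i ∈ s → ∀ x ∈ cube ι, |f i x| ≤ M := fun i => by
    by_cases hi : i ∈ s
    · obtain ⟨M, hM⟩ := (hf i hi).2
      exact ⟨M, fun _ => hM⟩
    · exact ⟨0, fun h => absurd h hi⟩
  choose M hM using hb
  refine ⟨Finset.measurable_sum s fun i hi => (hf i hi).1, ∑ i ∈ s, M i, fun x hx => ?_⟩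
  exact (Finset.abs_sum_le_sum_abs _ _).trans (Finset.sum_le_sum fun i hi => hM i hi x hx)

theorem BddMeas.prod_comp [Fintype ι] {w : ι → ℝ → ℝ} (hw : ∀ i, BddMeasUnit (w i)) :
    BddMeas (fun x : ι → ℝ => ∏ i, w i (x i)) := by
  choose hm M hM using hw
  refine ⟨Finset.measurable_prod _ fun i _ => (hm i).comp (measurable_pi_apply i), ∏ i, M i,
    fun x hx => ?_⟩
  rw [Finset.abs_prod]
  exact Finset.prod_le_prod (fun _ _ => abs_nonneg _) fun i _ => hM i _ (mem_cube.1 hx i)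

theorem BddMeasUnit.comp_eval {w : ℝ → ℝ} (hw : BddMeasUnit w) (j : ι) :
    BddMeas (fun x : ι → ℝ => w (x j)) := by
  obtain ⟨hm, M, hM⟩ := hw
  exact ⟨hm.comp (measurable_pi_apply j), M, fun x hx => hM _ (mem_cube.1 hx j)⟩

theorem BddMeas.comp_update_const [DecidableEq ι] {f : (ι → ℝ) → ℝ} (hf : BddMeas f) (j : ι)
    {t : ℝ}
    (ht : t ∈ Icc (0 : ℝ) 1) : BddMeas (fun x => f (Function.update x j t)) := by
  obtain ⟨hm, M, hM⟩ := hf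
  exact ⟨hm.comp measurable_update_left, M, fun x hx => hM _ (update_mem_cube hx j ht)⟩

theorem BddMeas.slice [DecidableEq ι] {f : (ι → ℝ) → ℝ} (hf : BddMeas f) (j : ι)
    {x : ι → ℝ} (hx : x ∈ cube ι) :
    BddMeasUnit (fun t => f (Function.update x j t)) := by
  obtain ⟨hm, M, hM⟩ := hf
  exact ⟨hm.comp (measurable_update x), M, fun t ht => hM _ (update_mem_cube hx j ht)⟩

theorem BddMeasUnit.mul {f g : ℝ → ℝ} (hf : BddMeasUnit f) (hg : BddMeasUnit g) :
    BddMeasUnit (fun x => f x * g x) := by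
  obtain ⟨hm, M, hM⟩ := hf
  obtain ⟨hm', M', hM'⟩ := hg
  refine ⟨hm.mul hm', M * M', fun x hx => ?_⟩
  rw [abs_mul]
  exact mul_le_mul (hM x hx) (hM' x hx) (abs_nonneg _) ((abs_nonneg _).trans (hM x hx))

theorem bddMeasUnit_of_continuous {w : ℝ → ℝ} (hw : Continuous w) : BddMeasUnit w := by
  refine ⟨hw.measurable, ?_⟩
  obtain ⟨M, hM⟩ := (isCompact_Icc (a := (0 : ℝ)) (b := 1)).exists_bound_of_continuousOn
    hw.continuousOn
  exact ⟨M, fun t ht => by simpa using hM t ht⟩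

end Cube

/-! ### Iterated primitives and integration by parts in one variable. -/

section Primitive

/-- The primitive of `φ` that vanishes at `0`. -/
noncomputable def primitive (φ : ℝ → ℝ) (t : ℝ) : ℝ := ∫ τ in (0 : ℝ)..t, φ τ

/-- An integral with a moving endpoint is an integral over a fixed space of the indicator of a
measurable region, so measurability follows from Fubini. -/
theorem measurable_integral_zero_to {X : Type*} [MeasurableSpace X] {F : X × ℝ → ℝ}
    (hF : Measurable F) {e : X → ℝ} (he : Measurable e) :
    Measurable (fun x => ∫ τ in (0 : ℝ)..e x, F (x, τ)) := by
  have key : ∀ a b : X → ℝ, Measurable a → Measurable b →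
      Measurable (fun x => ∫ τ in Ioc (a x) (b x), F (x, τ)) := by
    intro a b ha hb
    have hs : MeasurableSet {q : X × ℝ | a q.1 < q.2 ∧ q.2 ≤ b q.1} :=
      (measurableSet_lt (ha.comp measurable_fst) measurable_snd).inter
        (measurableSet_le measurable_snd (hb.comp measurable_fst))
    have h := ((hF.indicator hs).stronglyMeasurable.integral_prod_right'
      (ν := (volume : Measure ℝ))).measurable
    convert h using 2 with x
    rw [← integral_indicator measurableSet_Ioc]
    rfl
  simp only [intervalIntegral]
  exact (key _ _ measurable_const he).sub (key _ _ he measurable_const)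

theorem BddMeasUnit.primitive {φ : ℝ → ℝ} (hφ : BddMeasUnit φ) :
    BddMeasUnit (primitive φ) := by
  obtain ⟨hm, M, hM⟩ := hφ
  refine ⟨measurable_integral_zero_to (hm.comp measurable_snd) measurable_id, M, fun t ht => ?_⟩
  have h := intervalIntegral.norm_integral_le_of_norm_le_const (a := 0) (b := t) (C := M) (f := φ)
    fun τ hτ => by
      rw [uIoc_of_le ht.1] at hτ
      exact hM τ ⟨hτ.1.le, hτ.2.trans ht.2⟩
  have hM0 : 0 ≤ M := (abs_nonneg _).trans (hM t ht)
  rw [sub_zero, abs_of_nonneg ht.1, Real.norm_eq_abs] at h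
  exact h.trans (mul_le_of_le_one_right hM0 ht.2)

theorem BddMeasUnit.iterate_primitive {φ : ℝ → ℝ} (hφ : BddMeasUnit φ) (n : ℕ) :
    BddMeasUnit (WalshSobolev.primitive^[n] φ) := by
  induction n generalizing φ with
  | zero => exact hφ
  | succ n ih => exact ih hφ.primitive

theorem primitive_eqOn {φ ψ : ℝ → ℝ} (h : EqOn φ ψ (Icc 0 1)) :
    EqOn (primitive φ) (primitive ψ) (Icc 0 1) := by
  intro t ht
  refine intervalIntegral.integral_congr fun τ hτ => h ?_
  rw [uIcc_of_le ht.1] at hτ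
  exact ⟨hτ.1, hτ.2.trans ht.2⟩

theorem iterate_primitive_eqOn {φ ψ : ℝ → ℝ} (h : EqOn φ ψ (Icc 0 1)) (n : ℕ) :
    EqOn (primitive^[n] φ) (primitive^[n] ψ) (Icc 0 1) := by
  induction n generalizing φ ψ with
  | zero => exact h
  | succ n ih => exact ih (primitive_eqOn h)

/-- Both sides are integrals over the triangle `t ≤ x`, so Fubini suffices and no regularity of `G`
or `w` is used. The boundary term is `primitive w 1`. -/
theorem integral_primitive_mul {G w : ℝ → ℝ} (hG : BddMeasUnit G) (hw : BddMeasUnit w)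
    (h1 : primitive w 1 = 0) :
    ∫ t in (0 : ℝ)..1, primitive G t * w t = -∫ t in (0 : ℝ)..1, G t * primitive w t := by
  have hs : MeasurableSet {q : ℝ × ℝ | q.2 ≤ q.1} := measurableSet_le measurable_snd measurable_fst
  have hint : Integrable (Function.uncurry fun x t => indicator {q : ℝ × ℝ | q.2 ≤ q.1}
      (fun q => w q.1 * G q.2) (x, t)) (unitMeasure.prod unitMeasure) :=
    (hw.integrable.mul_prod hG.integrable).indicator hs
  have hswap := integral_integral_swap hint
  have e1 : ∀ x ∈ Icc (0 : ℝ) 1, ∫ t, indicator {q : ℝ × ℝ | q.2 ≤ q.1}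
      (fun q => w q.1 * G q.2) (x, t) ∂unitMeasure = primitive G x * w x := by
    intro x hx
    have : (fun t => indicator {q : ℝ × ℝ | q.2 ≤ q.1} (fun q => w q.1 * G q.2) (x, t)) =
        indicator (Iic x) (fun t => w x * G t) := by
      ext t; simp [indicator]
    rw [this, integral_indicator measurableSet_Iic, unitMeasure, Measure.restrict_restrict
      measurableSet_Iic, primitive, intervalIntegral.integral_of_le hx.1,
      ← integral_Icc_eq_integral_Ioc, integral_const_mul, mul_comm]
    congr 3
    ext t
    simp only [mem_inter_iff, mem_Iic, mem_Icc]
    exact ⟨fun h => ⟨h.2.1, h.1⟩, fun h => ⟨h.2, h.1, h.2.trans hx.2⟩⟩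
  have e2 : ∀ t ∈ Icc (0 : ℝ) 1, ∫ x, indicator {q : ℝ × ℝ | q.2 ≤ q.1}
      (fun q => w q.1 * G q.2) (x, t) ∂unitMeasure = -(G t * primitive w t) := by
    intro t ht
    have : (fun x => indicator {q : ℝ × ℝ | q.2 ≤ q.1} (fun q => w q.1 * G q.2) (x, t)) =
        indicator (Ici t) (fun x => w x * G t) := by
      ext x; simp [indicator]
    have h01 : (0 : ℝ) ∈ Icc (0 : ℝ) 1 := by simp
    have h11 : (1 : ℝ) ∈ Icc (0 : ℝ) 1 := by simp
    have hsub := intervalIntegral.integral_add_adjacent_intervals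
      (hw.intervalIntegrable h01 ht) (hw.intervalIntegrable ht h11)
    have hI : Ici t ∩ Icc (0 : ℝ) 1 = Icc t 1 := by
      ext x
      simp only [mem_inter_iff, mem_Ici, mem_Icc]
      exact ⟨fun h => ⟨h.1, h.2.2⟩, fun h => ⟨h.1, ht.1.trans h.1, h.2⟩⟩
    rw [this, integral_indicator measurableSet_Ici, unitMeasure, Measure.restrict_restrict
      measurableSet_Ici, hI, integral_mul_const, integral_Icc_eq_integral_Ioc,
      ← intervalIntegral.integral_of_le ht.2]
    simp only [primitive] at h1 ⊢
    linear_combination G t * hsub + G t * h1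
  rw [intervalIntegral.integral_of_le zero_le_one, intervalIntegral.integral_of_le zero_le_one,
    ← integral_Icc_eq_integral_Ioc, ← integral_Icc_eq_integral_Ioc, ← integral_neg,
    ← setIntegral_congr_fun measurableSet_Icc e1, ← setIntegral_congr_fun measurableSet_Icc e2]
  exact hswap

/-- The first `n` iterated primitives of `w` vanish at both ends of the unit interval. -/
def VanishingPrimitives (n : ℕ) (w : ℝ → ℝ) : Prop :=
  BddMeasUnit w ∧ ∀ i < n, primitive^[i + 1] w 1 = 0

theorem VanishingPrimitives.succ {n : ℕ} {w : ℝ → ℝ} (h : VanishingPrimitives (n + 1) w) :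
    VanishingPrimitives n (primitive w) :=
  ⟨h.1.primitive, fun i hi => h.2 (i + 1) (by omega)⟩

theorem integral_iterate_primitive_mul {n : ℕ} {G w : ℝ → ℝ} (hG : BddMeasUnit G)
    (hw : VanishingPrimitives n w) :
    ∫ t in (0 : ℝ)..1, primitive^[n] G t * w t =
      (-1) ^ n * ∫ t in (0 : ℝ)..1, G t * primitive^[n] w t := by
  induction n generalizing w with
  | zero => simp
  | succ n ih =>
    rw [Function.iterate_succ_apply', integral_primitive_mul (hG.iterate_primitive n) hw.1
      (hw.2 0 n.succ_pos), ih hw.succ, pow_succ, Function.iterate_succ_apply]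
    ring

/-- Each integration by parts lowers the degree of `P` and uses up one vanishing primitive of `w`;
the constant `P.eval 0` is killed by the mean of `w`. -/
theorem integral_polynomial_mul_eq_zero {n : ℕ} {P : Polynomial ℝ} (hP : P.degree < n)
    {w : ℝ → ℝ} (hw : VanishingPrimitives n w) : ∫ t in (0 : ℝ)..1, P.eval t * w t = 0 := by
  induction n generalizing P w with
  | zero =>
    have : P = 0 := by
      rw [Polynomial.degree_lt_iff_coeff_zero] at hP
      ext m
      rw [hP m m.zero_le, Polynomial.coeff_zero]
    subst this
    simp
  | succ n ih =>
    have hd : P.derivative.degree < n := by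
      rw [Polynomial.degree_lt_iff_coeff_zero] at hP ⊢
      intro m hm
      rw [Polynomial.coeff_derivative, hP (m + 1) (by omega), zero_mul]
    have hprim : ∀ t, P.eval t = P.eval 0 + primitive (fun τ => P.derivative.eval τ) t := by
      intro t
      rw [primitive, intervalIntegral.integral_eq_sub_of_hasDerivAt
        (fun x _ => P.hasDerivAt x) (P.derivative.continuous.intervalIntegrable _ _)]
      ring
    have hB : BddMeasUnit (fun τ => P.derivative.eval τ) :=
      bddMeasUnit_of_continuous P.derivative.continuous
    have h01 : (0 : ℝ) ∈ Icc (0 : ℝ) 1 := by simp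
    have h11 : (1 : ℝ) ∈ Icc (0 : ℝ) 1 := by simp
    have h0 : ∫ t in (0 : ℝ)..1, w t = 0 := hw.2 0 n.succ_pos
    simp_rw [fun t => congrArg (· * w t) (hprim t), add_mul]
    rw [intervalIntegral.integral_add ((hw.1.intervalIntegrable h01 h11).const_mul _)
      ((hB.primitive.mul hw.1).intervalIntegrable h01 h11), intervalIntegral.integral_const_mul, h0,
      integral_primitive_mul hB hw.1 (hw.2 0 n.succ_pos), ih hd hw.succ]
    simp

/-- Used to carry a constant of integration through the remaining primitives, where it becomes one
term of a Taylor polynomial. -/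
theorem iterate_primitive_monomial_add (n : ℕ) {G : ℝ → ℝ} (hG : IntegrableOn G (Icc 0 1))
    (c : ℝ) (k : ℕ) : ∃ c' : ℝ, EqOn (primitive^[n] fun t => c * t ^ k + G t)
      (fun t => c' * t ^ (k + n) + primitive^[n] G t) (Icc 0 1) := by
  induction n generalizing G c k with
  | zero => exact ⟨c, fun t _ => rfl⟩
  | succ n ih =>
    have hG' : IntegrableOn (primitive G) (Icc 0 1) := by
      refine ContinuousOn.integrableOn_Icc ?_
      have := intervalIntegral.continuousOn_primitive_interval (μ := volume) (f := G) (a := 0)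
        (b := 1) (by rwa [uIcc_of_le zero_le_one])
      rwa [uIcc_of_le zero_le_one] at this
    obtain ⟨c', hc'⟩ := ih hG' (c / (k + 1)) (k + 1)
    refine ⟨c', ?_⟩
    have h1 : EqOn (primitive fun t => c * t ^ k + G t)
        (fun t => c / (k + 1) * t ^ (k + 1) + primitive G t) (Icc 0 1) := by
      intro t ht
      have hi : IntervalIntegrable G volume 0 t := by
        refine (hG.mono_set ?_).intervalIntegrable
        rw [uIcc_of_le ht.1]
        exact Icc_subset_Icc le_rfl ht.2
      simp only [primitive]
      rw [intervalIntegral.integral_add (Continuous.intervalIntegrable (by fun_prop) _ _) hi,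
        intervalIntegral.integral_const_mul, integral_pow]
      ring
    intro t ht
    rw [Function.iterate_succ_apply, Function.iterate_succ_apply, iterate_primitive_eqOn h1 n ht,
      hc' ht]
    ring

theorem eqOn_primitive_of_hasDerivWithinAt {h g : ℝ → ℝ} (hg : IntegrableOn g (Icc 0 1))
    (hd : ∀ t ∈ Icc (0 : ℝ) 1, HasDerivWithinAt h (g t) (Icc 0 1) t) :
    EqOn h (fun t => h 0 + primitive g t) (Icc 0 1) := by
  intro t ht
  have hc : ContinuousOn h (Icc 0 1) := fun x hx => (hd x hx).continuousWithinAt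
  have := intervalIntegral.integral_eq_sub_of_hasDerivAt_of_le (f := h) (f' := g) ht.1
    (hc.mono (Icc_subset_Icc le_rfl ht.2))
    (fun x hx => (hd x ⟨hx.1.le, hx.2.le.trans ht.2⟩).hasDerivAt
      (Icc_mem_nhds hx.1 (hx.2.trans_le ht.2)))
    ((hg.mono_set (by rw [uIcc_of_le ht.1]; exact Icc_subset_Icc le_rfl ht.2)).intervalIntegrable)
  simp only [primitive]
  linarith

end Primitive

/-! ### From pointwise mixed derivatives to multivariate integration by parts. -/

section Reduction

variable {s : ℕ}

theorem IsIterPartialDeriv.congr_left {L : List (Fin s)} {f f' g : (Fin s → ℝ) → ℝ}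
    (h : IsIterPartialDeriv L f g) (hf : EqOn f f' (cube (Fin s))) : IsIterPartialDeriv L f' g := by
  induction L generalizing g with
  | nil => exact hf.symm.trans h
  | cons j L ih =>
    obtain ⟨k, hk, hkg⟩ := h
    exact ⟨k, ih hk, hkg⟩

theorem IsIterPartialDeriv.congr_right {L : List (Fin s)} {f g g' : (Fin s → ℝ) → ℝ}
    (h : IsIterPartialDeriv L f g) (hg : EqOn g g' (cube (Fin s))) : IsIterPartialDeriv L f g' := by
  cases L with
  | nil => exact EqOn.trans h hg
  | cons j L =>
    obtain ⟨k, hk, hkg⟩ := h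
    exact ⟨k, hk, fun x hx => hg hx ▸ hkg x hx⟩

theorem IsIterPartialDeriv.of_append {L₁ L₂ : List (Fin s)} {f g : (Fin s → ℝ) → ℝ}
    (h : IsIterPartialDeriv (L₁ ++ L₂) f g) :
    ∃ k, IsIterPartialDeriv L₂ f k ∧ IsIterPartialDeriv L₁ k g := by
  induction L₁ generalizing g with
  | nil => exact ⟨g, h, fun _ _ => rfl⟩
  | cons j L ih =>
    obtain ⟨k, hk, hkg⟩ := h
    obtain ⟨m, hm, hmk⟩ := ih hk
    exact ⟨m, hm, k, hmk, hkg⟩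

/-- The equidistant interpolation nodes `i / n` in the unit interval. -/
noncomputable def node (n i : ℕ) : ℝ := (i : ℝ) / n

theorem node_mem {n i : ℕ} (h : i ∈ Finset.range n) : node n i ∈ Icc (0 : ℝ) 1 := by
  have h' := Finset.mem_range.1 h
  have hn : (0 : ℝ) < n := by exact_mod_cast (Nat.zero_le i).trans_lt h'
  refine ⟨by unfold node; positivity, (div_le_one hn).2 (by exact_mod_cast h'.le)⟩

theorem node_injOn (n : ℕ) : Set.InjOn (node n) (Finset.range n) := by
  intro a ha b _ hab
  have hn : (n : ℝ) ≠ 0 := by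
    have := Finset.mem_range.1 ha
    exact_mod_cast (by omega : n ≠ 0)
  have := (div_left_inj' hn).1 hab
  exact_mod_cast this

/-- The Lagrange basis polynomials at the equidistant nodes. -/
noncomputable def nodeBasis (n i : ℕ) : Polynomial ℝ :=
  Lagrange.basis (Finset.range n) (node n) i

theorem degree_nodeBasis_lt {n i : ℕ} (h : i ∈ Finset.range n) : (nodeBasis n i).degree < n := by
  rw [nodeBasis, Lagrange.degree_basis (node_injOn n) h, Finset.card_range]
  have := Finset.mem_range.1 h
  exact_mod_cast (by omega : n - 1 < n)

theorem eval_eq_sum_nodeBasis {n : ℕ} {P : Polynomial ℝ} (hP : P.degree < n) (t : ℝ) :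
    P.eval t = ∑ i ∈ Finset.range n, (nodeBasis n i).eval t * P.eval (node n i) := by
  conv_lhs => rw [Lagrange.eq_interpolate (f := P) (node_injOn n) (by simpa using hP),
    Lagrange.interpolate_apply]
  simp only [Polynomial.eval_finsetSum, Polynomial.eval_mul, Polynomial.eval_C, nodeBasis]
  exact Finset.sum_congr rfl fun i _ => mul_comm _ _

/-- The remainder of Lagrange interpolation of `f` in the variable `j` with `n` nodes. -/
noncomputable def interpRemainder (n : ℕ) (j : Fin s) (f : (Fin s → ℝ) → ℝ) (x : Fin s → ℝ) : ℝ :=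
  f x - ∑ i ∈ Finset.range n, (nodeBasis n i).eval (x j) * f (Function.update x j (node n i))

theorem interpRemainder_eqOn (n : ℕ) (j : Fin s) {f g : (Fin s → ℝ) → ℝ}
    (h : EqOn f g (cube (Fin s))) :
    EqOn (interpRemainder n j f) (interpRemainder n j g) (cube (Fin s)) := by
  intro x hx
  simp only [interpRemainder, h hx]
  congr 1
  exact Finset.sum_congr rfl fun i hi => by rw [h (update_mem_cube hx j (node_mem hi))]

/-- Interpolation in `x j` combines finitely many slices of `f` with weights that depend on `x j`
only, so it commutes with differentiation in another variable. -/
theorem IsPartialDeriv.interpRemainder (n : ℕ) {i j : Fin s} (hij : j ≠ i)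
    {f g : (Fin s → ℝ) → ℝ} (h : IsPartialDeriv i f g) :
    IsPartialDeriv i (interpRemainder n j f) (interpRemainder n j g) := by
  intro x hx
  simp only [WalshSobolev.interpRemainder]
  refine (h x hx).sub (HasDerivWithinAt.fun_sum fun m hm => ?_)
  simp only [Function.update_of_ne hij]
  refine HasDerivWithinAt.const_mul _ ?_
  have := h _ (update_mem_cube hx j (node_mem hm))
  rw [Function.update_of_ne hij.symm] at this
  simpa only [Function.update_comm hij] using this

theorem IsIterPartialDeriv.interpRemainder (n : ℕ) {j : Fin s} {L : List (Fin s)} (hj : j ∉ L)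
    {f g : (Fin s → ℝ) → ℝ} (h : IsIterPartialDeriv L f g) :
    IsIterPartialDeriv L (interpRemainder n j f) (interpRemainder n j g) := by
  induction L generalizing g with
  | nil => exact interpRemainder_eqOn n j h
  | cons i L ih =>
    obtain ⟨k, hk, hkg⟩ := h
    rw [List.mem_cons, not_or] at hj
    exact ⟨_, ih hj.2 hk, hkg.interpRemainder n hj.1⟩

theorem BddMeas.interpRemainder (n : ℕ) (j : Fin s) {f : (Fin s → ℝ) → ℝ} (hf : BddMeas f) :
    BddMeas (interpRemainder n j f) :=
  hf.sub (BddMeas.sum _ fun i hi =>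
    ((bddMeasUnit_of_continuous (nodeBasis n i).continuous).comp_eval j).mul
      (hf.comp_update_const j (node_mem hi)))

/-- The primitive of `g` in the variable `j` that vanishes for `x_j = 0`. -/
noncomputable def coordPrimitive (j : Fin s) (g : (Fin s → ℝ) → ℝ) (x : Fin s → ℝ) : ℝ :=
  primitive (fun t => g (Function.update x j t)) (x j)

theorem iterate_coordPrimitive_update (n : ℕ) (j : Fin s) (g : (Fin s → ℝ) → ℝ) (x : Fin s → ℝ)
    (t : ℝ) : (coordPrimitive j)^[n] g (Function.update x j t) =
      primitive^[n] (fun t => g (Function.update x j t)) t := by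
  induction n generalizing g with
  | zero => rfl
  | succ n ih =>
    rw [Function.iterate_succ_apply, Function.iterate_succ_apply, ih]
    refine congrFun (congrArg _ (funext fun τ => ?_)) t
    simp [coordPrimitive]

theorem BddMeas.coordPrimitive {g : (Fin s → ℝ) → ℝ} (hg : BddMeas g) (j : Fin s) :
    BddMeas (coordPrimitive j g) := by
  obtain ⟨hm, M, hM⟩ := hg
  refine ⟨measurable_integral_zero_to (hm.comp (measurable_update_pair j))
    (measurable_pi_apply j), M, fun x hx => ?_⟩
  have hxj := mem_cube.1 hx j
  have h := intervalIntegral.norm_integral_le_of_norm_le_const (a := 0) (b := x j) (C := M)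
    (f := fun t => g (Function.update x j t)) fun τ hτ => by
      rw [uIoc_of_le hxj.1] at hτ
      exact hM _ (update_mem_cube hx j ⟨hτ.1.le, hτ.2.trans hxj.2⟩)
  have hM0 : 0 ≤ M := (abs_nonneg _).trans (hM x hx)
  rw [sub_zero, abs_of_nonneg hxj.1, Real.norm_eq_abs] at h
  exact h.trans (mul_le_of_le_one_right hM0 hxj.2)

theorem BddMeas.iterate_coordPrimitive {g : (Fin s → ℝ) → ℝ} (hg : BddMeas g) (j : Fin s) (n : ℕ) :
    BddMeas ((WalshSobolev.coordPrimitive j)^[n] g) := by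
  induction n generalizing g with
  | zero => exact hg
  | succ n ih => exact ih (hg.coordPrimitive j)

/-- Taylor's formula on one line. The coefficients of `P` depend on the other variables in a way
that need not be measurable, which is why the interpolation remainder is needed afterwards. -/
theorem IsIterPartialDeriv.exists_polynomial {n : ℕ} {j : Fin s} {f g : (Fin s → ℝ) → ℝ}
    (h : IsIterPartialDeriv (List.replicate n j) f g) {x : Fin s → ℝ} (hx : x ∈ cube (Fin s))
    (hg : IntegrableOn (fun t => g (Function.update x j t)) (Icc 0 1)) :
    ∃ P : Polynomial ℝ, P.degree < n ∧ EqOn (fun t => f (Function.update x j t))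
      (fun t => P.eval t + primitive^[n] (fun t => g (Function.update x j t)) t) (Icc 0 1) := by
  induction n generalizing g with
  | zero =>
    refine ⟨0, by simp, fun t ht => ?_⟩
    simpa using h (update_mem_cube hx j ht)
  | succ n ih =>
    obtain ⟨k, hk, hkg⟩ := h
    have hd : ∀ t ∈ Icc (0 : ℝ) 1, HasDerivWithinAt (fun t => k (Function.update x j t))
        (g (Function.update x j t)) (Icc 0 1) t := by
      intro t ht
      simpa using hkg _ (update_mem_cube hx j ht)
    have hk' : IntegrableOn (fun t => k (Function.update x j t)) (Icc 0 1) :=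
      ContinuousOn.integrableOn_Icc fun t ht => (hd t ht).continuousWithinAt
    obtain ⟨P, hP, hPk⟩ := ih hk hk'
    have he := eqOn_primitive_of_hasDerivWithinAt hg hd
    have hG' : IntegrableOn (primitive fun t => g (Function.update x j t)) (Icc 0 1) := by
      refine ContinuousOn.integrableOn_Icc ?_
      have := intervalIntegral.continuousOn_primitive_interval (μ := volume)
        (f := fun t => g (Function.update x j t)) (a := 0)
        (b := 1) (by rwa [uIcc_of_le zero_le_one])
      rwa [uIcc_of_le zero_le_one] at this
    obtain ⟨c, hc⟩ := iterate_primitive_monomial_add n hG' (k (Function.update x j 0)) 0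
    refine ⟨P + Polynomial.C c * Polynomial.X ^ n, ?_, fun t ht => ?_⟩
    · refine (Polynomial.degree_add_le _ _).trans_lt (max_lt (hP.trans ?_) ?_)
      · exact_mod_cast n.lt_succ_self
      · exact (Polynomial.degree_C_mul_X_pow_le n c).trans_lt (by exact_mod_cast n.lt_succ_self)
    · have h2 := hc ht
      simp only [pow_zero, mul_one, zero_add] at h2
      have h1 := hPk ht
      simp only at h1 ⊢
      rw [h1, iterate_primitive_eqOn he n ht, h2, Function.iterate_succ_apply]
      simp only [Polynomial.eval_add, Polynomial.eval_mul, Polynomial.eval_C, Polynomial.eval_pow,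
        Polynomial.eval_X]
      ring

/-- Interpolation at `n` nodes reproduces polynomials of degree below `n`, so the uncontrolled
Taylor polynomial cancels and what remains is determined by `g` alone. -/
theorem IsIterPartialDeriv.interpRemainder_eqOn {n : ℕ} {j : Fin s} {f g : (Fin s → ℝ) → ℝ}
    (h : IsIterPartialDeriv (List.replicate n j) f g) (hg : BddMeas g) :
    EqOn (WalshSobolev.interpRemainder n j f)
      (WalshSobolev.interpRemainder n j ((coordPrimitive j)^[n] g)) (cube (Fin s)) := by
  intro x hx
  obtain ⟨P, hP, he⟩ := h.exists_polynomial hx (hg.slice j hx).integrable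
  have hval : ∀ t ∈ Icc (0 : ℝ) 1, f (Function.update x j t) =
      P.eval t + (coordPrimitive j)^[n] g (Function.update x j t) := by
    intro t ht
    rw [iterate_coordPrimitive_update]
    exact he ht
  have hx0 := hval (x j) (mem_cube.1 hx j)
  rw [Function.update_eq_self] at hx0
  simp only [WalshSobolev.interpRemainder]
  have hsum : ∑ i ∈ Finset.range n, (nodeBasis n i).eval (x j) * f (Function.update x j (node n i)) =
      P.eval (x j) + ∑ i ∈ Finset.range n, (nodeBasis n i).eval (x j) *
        (coordPrimitive j)^[n] g (Function.update x j (node n i)) := by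
    rw [eval_eq_sum_nodeBasis hP, ← Finset.sum_add_distrib]
    exact Finset.sum_congr rfl fun i hi => by rw [hval _ (node_mem hi), mul_add]
  rw [hx0, hsum]
  ring

theorem prod_update_eq (w : Fin s → ℝ → ℝ) (x : Fin s → ℝ) (j : Fin s) (t : ℝ) :
    ∏ i, w i (Function.update x j t i) = w j t * ∏ i ∈ Finset.univ.erase j, w i (x i) := by
  rw [← Finset.mul_prod_erase _ _ (Finset.mem_univ j), Function.update_self]
  congr 1
  exact Finset.prod_congr rfl fun i hi => by rw [Function.update_of_ne (Finset.ne_of_mem_erase hi)]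

/-- Each subtracted term is a polynomial of degree below `n` in `x j` times a function free of `x
j`, hence is orthogonal to `w j`. -/
theorem integral_interpRemainder_mul {n : ℕ} {j : Fin s} {F : (Fin s → ℝ) → ℝ} (hF : BddMeas F)
    {w : Fin s → ℝ → ℝ} (hw : ∀ i, BddMeasUnit (w i)) (hj : VanishingPrimitives n (w j)) :
    ∫ x, interpRemainder n j F x * ∏ i, w i (x i) ∂cubeMeasure (Fin s) =
      ∫ x, F x * ∏ i, w i (x i) ∂cubeMeasure (Fin s) := by
  have hW := BddMeas.prod_comp hw
  have hb : ∀ i ∈ Finset.range n, BddMeas (fun x : Fin s → ℝ =>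
      (nodeBasis n i).eval (x j) * F (Function.update x j (node n i)) * ∏ i, w i (x i)) :=
    fun i hi => ((((bddMeasUnit_of_continuous (nodeBasis n i).continuous).comp_eval j).mul
      (hF.comp_update_const j (node_mem hi)))).mul hW
  simp only [interpRemainder, sub_mul, Finset.sum_mul]
  rw [integral_sub (hF.mul hW).integrable (BddMeas.sum _ hb).integrable,
    integral_finsetSum _ fun i hi => (hb i hi).integrable, Finset.sum_eq_zero, sub_zero]
  intro i hi
  rw [integral_cube_update j (hb i hi).integrable]
  refine integral_eq_zero_of_ae (Filter.Eventually.of_forall fun x => ?_)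
  simp only [Function.update_self, Function.update_idem, prod_update_eq, Pi.zero_apply]
  have h0 := integral_polynomial_mul_eq_zero (degree_nodeBasis_lt hi) hj
  calc _ = ∫ t in (0 : ℝ)..1, ((nodeBasis n i).eval t * w j t) *
        (F (Function.update x j (node n i)) * ∏ i ∈ Finset.univ.erase j, w i (x i)) := by
        congr 1; ext t; ring
    _ = 0 := by rw [intervalIntegral.integral_mul_const, h0, zero_mul]

theorem integral_iterate_coordPrimitive_mul {n : ℕ} {j : Fin s} {g : (Fin s → ℝ) → ℝ}
    (hg : BddMeas g) {w : Fin s → ℝ → ℝ} (hw : ∀ i, BddMeasUnit (w i))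
    (hj : VanishingPrimitives n (w j)) :
    ∫ x, (coordPrimitive j)^[n] g x * ∏ i, w i (x i) ∂cubeMeasure (Fin s) =
      (-1) ^ n * ∫ x, g x * ∏ i, Function.update w j (primitive^[n] (w j)) i (x i)
        ∂cubeMeasure (Fin s) := by
  have hw' : ∀ i, BddMeasUnit (Function.update w j (primitive^[n] (w j)) i) := by
    intro i
    by_cases h : i = j
    · subst h; simpa using (hw i).iterate_primitive n
    · simpa [h] using hw i
  rw [integral_cube_update j ((hg.iterate_coordPrimitive j n).mul (BddMeas.prod_comp hw)).integrable,
    integral_cube_update j (hg.mul (BddMeas.prod_comp hw')).integrable, ← integral_const_mul]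
  refine integral_congr_ae (ae_mem_cube.mono fun x hx => ?_)
  simp only [iterate_coordPrimitive_update, prod_update_eq, Function.update_self]
  have hprod : ∏ i ∈ Finset.univ.erase j, Function.update w j (primitive^[n] (w j)) i (x i) =
      ∏ i ∈ Finset.univ.erase j, w i (x i) :=
    Finset.prod_congr rfl fun i hi => by rw [Function.update_of_ne (Finset.ne_of_mem_erase hi)]
  rw [hprod]
  simp only [← mul_assoc, intervalIntegral.integral_mul_const]
  rw [integral_iterate_primitive_mul (hg.slice j hx) hj]

/-- Integration by parts against products of univariate functions, for a mixed derivative all of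
whose intermediate derivatives are only assumed to exist pointwise. -/
theorem integral_mul_prod_of_isIterPartialDeriv {n : ℕ} {J : List (Fin s)} (hJ : J.Nodup)
    {f g : (Fin s → ℝ) → ℝ} (hf : BddMeas f) (hg : BddMeas g)
    (h : IsIterPartialDeriv (J.flatMap fun j => List.replicate n j) f g) {w : Fin s → ℝ → ℝ}
    (hw : ∀ i, VanishingPrimitives n (w i)) :
    ∫ x, f x * ∏ i, w i (x i) ∂cubeMeasure (Fin s) =
      ((-1) ^ n) ^ J.length * ∫ x, g x * ∏ i, (if i ∈ J then primitive^[n] (w i) else w i) (x i)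
        ∂cubeMeasure (Fin s) := by
  induction J generalizing f g with
  | nil =>
    simp only [List.length_nil, pow_zero, one_mul, List.not_mem_nil, if_false]
    refine integral_congr_ae (ae_mem_cube.mono fun x hx => ?_)
    simp only
    rw [h hx]
  | cons j J ih =>
    obtain ⟨k, hk, hkg⟩ := IsIterPartialDeriv.of_append (by simpa using h)
    rw [List.nodup_cons] at hJ
    have hjL : j ∉ J.flatMap fun j => List.replicate n j := by
      rw [List.mem_flatMap]
      rintro ⟨i, hi, hij⟩
      exact hJ.1 (List.eq_of_mem_replicate hij ▸ hi)
    have hIg := hg.iterate_coordPrimitive j n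
    -- The intermediate derivative `k` is not known to be measurable, so the induction hypothesis
    -- cannot be applied to `f` and `k`. Their remainders in `j` qualify: that of `k` equals the
    -- remainder of an iterated primitive of `g`.
    have hstep := ih hJ.2 (hf.interpRemainder n j) (hIg.interpRemainder n j)
      ((hk.interpRemainder n hjL).congr_right (hkg.interpRemainder_eqOn hg))
    have hv : ∀ i, BddMeasUnit (if i ∈ J then primitive^[n] (w i) else w i) := by
      intro i
      split_ifs
      · exact (hw i).1.iterate_primitive n
      · exact (hw i).1
    have hvj : (if j ∈ J then primitive^[n] (w j) else w j) = w j := if_neg hJ.1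
    rw [integral_interpRemainder_mul hf (fun i => (hw i).1) (hw j),
      integral_interpRemainder_mul hIg (w := fun i => if i ∈ J then primitive^[n] (w i) else w i)
        hv (by simpa only [hvj] using hw j),
      integral_iterate_coordPrimitive_mul hg
        (w := fun i => if i ∈ J then primitive^[n] (w i) else w i) hv
        (by simpa only [hvj] using hw j)] at hstep
    rw [hstep, List.length_cons, pow_succ, mul_assoc]
    congr 2
    refine congrArg _ (funext fun x => ?_)
    congr 1
    refine Finset.prod_congr rfl fun i _ => ?_
    by_cases hi : i = j
    · subst hi; simp [hJ.1]
    · simp [hi]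

end Reduction

/-! ### Rademacher functions and the iterated primitives of their products. -/

section Walsh

/-- The Rademacher function at the bit position `m`. -/
noncomputable def rad (m : ℕ) (x : ℝ) : ℝ := (-1) ^ ⌊(2 : ℝ) ^ m * x⌋₊

theorem wal_eq_prod_rad (k : ℕ) (x : ℝ) : wal k x = ∏ m ∈ nonzeroBits k, rad m x := by
  rw [wal, ← Finset.prod_pow_eq_pow_sum]
  exact Finset.prod_congr rfl fun m _ => (neg_one_pow_eq_pow_mod_two _).symm

theorem abs_rad (m : ℕ) (x : ℝ) : |rad m x| = 1 := abs_neg_one_pow _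

theorem measurable_rad (m : ℕ) : Measurable (rad m) :=
  (measurable_from_nat (f := fun n : ℕ => (-1 : ℝ) ^ n)).comp
    (Nat.measurable_floor.comp (measurable_const.mul measurable_id))

theorem rad_add {m : ℕ} {x : ℝ} (hx : 0 ≤ x) : rad m (x + ((2 : ℝ) ^ m)⁻¹) = -rad m x := by
  have h2 : (2 : ℝ) ^ m ≠ 0 := by positivity
  rw [rad, mul_add, mul_inv_cancel₀ h2, Nat.floor_add_one (by positivity), pow_succ, rad]
  ring

theorem rad_eq_one {m : ℕ} {x : ℝ} (hx : x < ((2 : ℝ) ^ m)⁻¹) : rad m x = 1 := by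
  have h2 : (0 : ℝ) < (2 : ℝ) ^ m := by positivity
  have : ⌊(2 : ℝ) ^ m * x⌋₊ = 0 := by
    rw [Nat.floor_eq_zero, mul_comm]
    rwa [← one_div, lt_div_iff₀ h2] at hx
  rw [rad, this, pow_zero]

/-- Functions bounded by one that are constant on the dyadic intervals of length `2 ^ (-n)`. -/
structure DyadicConst (n : ℕ) (χ : ℝ → ℝ) : Prop where
  measurable : Measurable χ
  abs_le : ∀ x, |χ x| ≤ 1
  const : ∀ x y, ⌊(2 : ℝ) ^ n * x⌋₊ = ⌊(2 : ℝ) ^ n * y⌋₊ → χ x = χ y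

theorem floor_two_pow_mul {n m : ℕ} (h : n ≤ m) (x : ℝ) :
    ⌊(2 : ℝ) ^ n * x⌋₊ = ⌊(2 : ℝ) ^ m * x⌋₊ / 2 ^ (m - n) := by
  rw [← Nat.floor_div_natCast]
  congr 1
  push_cast
  rw [eq_div_iff (by positivity), mul_right_comm, ← pow_add, Nat.add_sub_cancel' h]

theorem DyadicConst.mono {n m : ℕ} {χ : ℝ → ℝ} (h : DyadicConst n χ) (hnm : n ≤ m) :
    DyadicConst m χ :=
  ⟨h.1, h.2, fun x y hxy => h.3 x y (by rw [floor_two_pow_mul hnm, hxy, floor_two_pow_mul hnm])⟩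

theorem DyadicConst.mul {n : ℕ} {χ ψ : ℝ → ℝ} (h : DyadicConst n χ) (h' : DyadicConst n ψ) :
    DyadicConst n (fun x => χ x * ψ x) :=
  ⟨h.1.mul h'.1, fun x => by
    rw [abs_mul]; exact mul_le_one₀ (h.2 x) (abs_nonneg _) (h'.2 x),
    fun x y hxy => by rw [h.3 x y hxy, h'.3 x y hxy]⟩

theorem dyadicConst_rad (m : ℕ) : DyadicConst m (rad m) :=
  ⟨measurable_rad m, fun x => (abs_rad m x).le, fun x y h => by rw [rad, rad, h]⟩

theorem dyadicConst_prod_rad {n : ℕ} {S : Finset ℕ} (hS : ∀ m ∈ S, m ≤ n) :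
    DyadicConst n (fun x => ∏ m ∈ S, rad m x) := by
  refine ⟨Finset.measurable_prod _ fun m _ => measurable_rad m, fun x => ?_, fun x y h => ?_⟩
  · rw [Finset.abs_prod, Finset.prod_congr rfl fun m _ => abs_rad m x, Finset.prod_const_one]
  · exact Finset.prod_congr rfl fun m hm => ((dyadicConst_rad m).mono (hS m hm)).const x y h

/-- Functions on the half-line with values in `[0, M]` and period `2 ^ (-n)`. -/
structure DyadicPeriodic (n : ℕ) (M : ℝ) (φ : ℝ → ℝ) : Prop where
  measurable : Measurable φ
  intervalIntegrable : ∀ a b, IntervalIntegrable φ volume a b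
  nonneg : ∀ x, 0 ≤ x → 0 ≤ φ x
  le : ∀ x, 0 ≤ x → φ x ≤ M
  period : ∀ x, 0 ≤ x → φ (x + ((2 : ℝ) ^ n)⁻¹) = φ x

theorem DyadicPeriodic.period_mul {n : ℕ} {M : ℝ} {φ : ℝ → ℝ} (h : DyadicPeriodic n M φ) (i : ℕ)
    {x : ℝ} (hx : 0 ≤ x) : φ (x + i * ((2 : ℝ) ^ n)⁻¹) = φ x := by
  induction i with
  | zero => simp
  | succ i ih =>
    rw [Nat.cast_succ, add_mul, one_mul, ← add_assoc, h.period _ (by positivity), ih]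

theorem DyadicPeriodic.mono {n m : ℕ} {M : ℝ} {φ : ℝ → ℝ} (h : DyadicPeriodic m M φ)
    (hnm : n ≤ m) : DyadicPeriodic n M φ := by
  refine ⟨h.1, h.2, h.3, h.4, fun x hx => ?_⟩
  have : ((2 : ℝ) ^ n)⁻¹ = ((2 ^ (m - n) : ℕ) : ℝ) * ((2 : ℝ) ^ m)⁻¹ := by
    push_cast
    rw [← div_eq_mul_inv, eq_div_iff (by positivity), inv_mul_eq_iff_eq_mul₀ (by positivity),
      ← pow_add, Nat.add_sub_cancel' hnm]
  rw [this, h.period_mul _ hx]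

theorem intervalIntegrable_mul_of_abs_le_one {φ χ : ℝ → ℝ} {a b : ℝ}
    (h : IntervalIntegrable φ volume a b) (hm : Measurable χ) (hχ : ∀ x, |χ x| ≤ 1) :
    IntervalIntegrable (fun x => φ x * χ x) volume a b := by
  rw [intervalIntegrable_iff] at *
  exact h.mul_bdd (c := 1) hm.aestronglyMeasurable (Filter.Eventually.of_forall hχ)

section Step

variable {n : ℕ} {M : ℝ} {φ : ℝ → ℝ}

/-- Shifting by half a dyadic cell keeps `φ` and flips the sign of `rad (n + 1)`. The periodicity,
zeros and bounds of the primitive all come from this reflection. -/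
theorem primitive_mul_rad_add (h : DyadicPeriodic (n + 1) M φ) {x : ℝ} (hx : 0 ≤ x) :
    primitive (fun t => φ t * rad (n + 1) t) (x + ((2 : ℝ) ^ (n + 1))⁻¹) =
      primitive (fun t => φ t * rad (n + 1) t) ((2 : ℝ) ^ (n + 1))⁻¹ -
        primitive (fun t => φ t * rad (n + 1) t) x := by
  set δ : ℝ := ((2 : ℝ) ^ (n + 1))⁻¹ with hδ
  have hi : ∀ a b, IntervalIntegrable (fun t => φ t * rad (n + 1) t) volume a b := fun a b =>
    intervalIntegrable_mul_of_abs_le_one (h.intervalIntegrable a b) (measurable_rad _)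
      fun x => (abs_rad _ x).le
  have h1 := intervalIntegral.integral_comp_add_right (a := 0) (b := x)
    (fun t => φ t * rad (n + 1) t) δ
  have h2 : ∫ t in (0 : ℝ)..x, φ (t + δ) * rad (n + 1) (t + δ) =
      -∫ t in (0 : ℝ)..x, φ t * rad (n + 1) t := by
    rw [← intervalIntegral.integral_neg]
    refine intervalIntegral.integral_congr fun t ht => ?_
    rw [uIcc_of_le hx] at ht
    rw [h.period t ht.1, rad_add ht.1]
    ring
  rw [zero_add] at h1
  simp only [primitive]
  rw [← intervalIntegral.integral_add_adjacent_intervals (hi 0 δ) (hi δ (x + δ)), ← h1, h2]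
  ring

theorem primitive_mul_rad_period (h : DyadicPeriodic (n + 1) M φ) {x : ℝ} (hx : 0 ≤ x) :
    primitive (fun t => φ t * rad (n + 1) t) (x + ((2 : ℝ) ^ n)⁻¹) =
      primitive (fun t => φ t * rad (n + 1) t) x := by
  have h2 : ((2 : ℝ) ^ n)⁻¹ = ((2 : ℝ) ^ (n + 1))⁻¹ + ((2 : ℝ) ^ (n + 1))⁻¹ := by
    rw [pow_succ, mul_inv]; ring
  rw [h2, ← add_assoc, primitive_mul_rad_add h (by positivity), primitive_mul_rad_add h hx]
  ring

theorem primitive_mul_rad_nat (h : DyadicPeriodic (n + 1) M φ) (i : ℕ) :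
    primitive (fun t => φ t * rad (n + 1) t) (i * ((2 : ℝ) ^ n)⁻¹) = 0 := by
  induction i with
  | zero => simp [primitive]
  | succ i ih =>
    rw [Nat.cast_succ, add_mul, one_mul, primitive_mul_rad_period h (by positivity), ih]

/-- On the first half cell the Rademacher factor is one, so the primitive increases from `0` to its
value at `δ`, at most `δ * M`. The reflection in `primitive_mul_rad_add` keeps it in that range on
every later half cell. -/
theorem primitive_mul_rad_bounds (h : DyadicPeriodic (n + 1) M φ) {x : ℝ} (hx : 0 ≤ x) :
    0 ≤ primitive (fun t => φ t * rad (n + 1) t) x ∧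
      primitive (fun t => φ t * rad (n + 1) t) x ≤ ((2 : ℝ) ^ (n + 1))⁻¹ * M := by
  set δ : ℝ := ((2 : ℝ) ^ (n + 1))⁻¹ with hδ
  have hδ0 : 0 < δ := by positivity
  have hM : 0 ≤ M := (h.nonneg 0 le_rfl).trans (h.le 0 le_rfl)
  have hsmall : ∀ x, 0 ≤ x → x ≤ δ → primitive (fun t => φ t * rad (n + 1) t) x =
      ∫ t in (0 : ℝ)..x, φ t := by
    intro x hx hxδ
    -- The Rademacher function already jumps at `δ`, so that point is discarded as a null set.
    refine intervalIntegral.integral_congr_ae ?_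
    filter_upwards [Measure.ae_ne volume δ] with t ht htx
    rw [uIoc_of_le hx] at htx
    rw [rad_eq_one (lt_of_le_of_ne (htx.2.trans hxδ) ht), mul_one]
  have hle : ∀ a b : ℝ, 0 ≤ a → a ≤ b → 0 ≤ ∫ t in a..b, φ t := fun a b ha hab =>
    intervalIntegral.integral_nonneg hab fun t ht => h.nonneg t (ha.trans ht.1)
  have hFδ : primitive (fun t => φ t * rad (n + 1) t) δ ≤ δ * M := by
    rw [hsmall δ hδ0.le le_rfl]
    have := intervalIntegral.integral_mono_on hδ0.le (h.intervalIntegrable 0 δ)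
      (intervalIntegrable_const (μ := volume) (c := M)) fun t ht => h.le t ht.1
    simpa using this
  have main : ∀ i : ℕ, ∀ x, 0 ≤ x → x ≤ (i + 1) * δ →
      0 ≤ primitive (fun t => φ t * rad (n + 1) t) x ∧
      primitive (fun t => φ t * rad (n + 1) t) x ≤
        primitive (fun t => φ t * rad (n + 1) t) δ := by
    intro i
    induction i with
    | zero =>
      intro x hx hxδ
      simp only [Nat.cast_zero, zero_add, one_mul] at hxδ
      rw [hsmall x hx hxδ, hsmall δ hδ0.le le_rfl, ← intervalIntegral.integral_add_adjacent_intervals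
        (h.intervalIntegrable 0 x) (h.intervalIntegrable x δ)]
      exact ⟨hle _ _ le_rfl hx, le_add_of_nonneg_right (hle _ _ hx hxδ)⟩
    | succ i ih =>
      intro x hx hxi
      by_cases hc : x ≤ (i + 1) * δ
      · exact ih x hx hc
      · push Not at hc
        have hxδ : 0 ≤ x - δ := by
          have : (0 : ℝ) ≤ i * δ := by positivity
          linarith
        push_cast at hxi
        obtain ⟨h1, h2⟩ := ih (x - δ) hxδ (by linarith)
        have := primitive_mul_rad_add h hxδ
        rw [← hδ, sub_add_cancel] at this
        rw [this]
        exact ⟨by linarith, by linarith⟩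
  obtain ⟨i, hi⟩ := exists_nat_ge (x / δ)
  obtain ⟨h1, h2⟩ := main i x hx (by
    rw [div_le_iff₀ hδ0] at hi
    linarith)
  exact ⟨h1, h2.trans hFδ⟩

theorem DyadicPeriodic.primitive_mul_rad (h : DyadicPeriodic (n + 1) M φ) :
    DyadicPeriodic n (((2 : ℝ) ^ (n + 1))⁻¹ * M) (primitive fun t => φ t * rad (n + 1) t) := by
  refine ⟨measurable_integral_zero_to ((h.measurable.mul (measurable_rad _)).comp measurable_snd)
    measurable_id, fun a b => Continuous.intervalIntegrable ?_ a b,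
    fun x hx => (primitive_mul_rad_bounds h hx).1, fun x hx => (primitive_mul_rad_bounds h hx).2,
    fun x hx => primitive_mul_rad_period h hx⟩
  exact intervalIntegral.continuous_primitive (fun a b => intervalIntegrable_mul_of_abs_le_one
    (h.intervalIntegrable a b) (measurable_rad _) fun x => (abs_rad _ x).le) 0

/-- The primitive without `χ` vanishes at both ends of each cell of length `2 ^ (-n)`, and `χ` is
constant there; cell by cell `χ` comes out of the integral with nothing carried over. -/
theorem primitive_mul_rad_mul (h : DyadicPeriodic (n + 1) M φ) {χ : ℝ → ℝ} (hχ : DyadicConst n χ)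
    {x : ℝ} (hx : 0 ≤ x) : primitive (fun t => φ t * (rad (n + 1) t * χ t)) x =
      primitive (fun t => φ t * rad (n + 1) t) x * χ x := by
  set P : ℝ := ((2 : ℝ) ^ n)⁻¹ with hP
  have h2 : (0 : ℝ) < 2 ^ n := by positivity
  have hP0 : 0 < P := by positivity
  have hi : ∀ a b, IntervalIntegrable (fun t => φ t * rad (n + 1) t) volume a b := fun a b =>
    intervalIntegrable_mul_of_abs_le_one (h.intervalIntegrable a b) (measurable_rad _)
      fun x => (abs_rad _ x).le
  have hiχ : ∀ a b, IntervalIntegrable (fun t => φ t * (rad (n + 1) t * χ t)) volume a b := by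
    intro a b
    simp only [← mul_assoc]
    exact intervalIntegrable_mul_of_abs_le_one (hi a b) hχ.1 hχ.2
  have hcell : ∀ (i : ℕ) (t : ℝ), i * P ≤ t → t < (i + 1) * P → χ t = χ (i * P) := by
    intro i t h1 h3
    refine hχ.const _ _ ?_
    have e1 : ⌊(2 : ℝ) ^ n * t⌋₊ = i := by
      rw [Nat.floor_eq_iff (mul_nonneg h2.le ((by positivity : (0 : ℝ) ≤ i * P).trans h1))]
      rw [hP, ← div_eq_mul_inv, div_le_iff₀ h2] at h1
      rw [hP, ← div_eq_mul_inv, lt_div_iff₀ h2] at h3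
      constructor <;> linarith
    rw [e1, hP, mul_left_comm, mul_inv_cancel₀ h2.ne', mul_one, Nat.floor_natCast]
  have hstep : ∀ i : ℕ, primitive (fun t => φ t * (rad (n + 1) t * χ t)) (i * P) = 0 →
      ∀ x : ℝ, i * P ≤ x → x ≤ (i + 1) * P →
      primitive (fun t => φ t * (rad (n + 1) t * χ t)) x =
      primitive (fun t => φ t * rad (n + 1) t) x * χ (i * P) := by
    intro i h0 x h1 h3
    have e0 := primitive_mul_rad_nat h i
    have e1 : ∫ t in (i * P)..x, φ t * (rad (n + 1) t * χ t) =
        ∫ t in (i * P)..x, φ t * rad (n + 1) t * χ (i * P) := by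
      refine intervalIntegral.integral_congr_ae ?_
      filter_upwards [Measure.ae_ne volume ((i + 1) * P)] with t ht htx
      rw [uIoc_of_le h1] at htx
      rw [hcell i t htx.1.le (lt_of_le_of_ne (htx.2.trans h3) ht), mul_assoc]
    rw [intervalIntegral.integral_mul_const] at e1
    simp only [primitive] at *
    rw [← intervalIntegral.integral_add_adjacent_intervals (hiχ 0 (i * P)) (hiχ (i * P) x), h0,
      e1, ← intervalIntegral.integral_add_adjacent_intervals (hi 0 (i * P)) (hi (i * P) x), e0]
    ring
  have main : ∀ (i : ℕ) (x : ℝ), i * P ≤ x → x ≤ (i + 1) * P →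
      primitive (fun t => φ t * (rad (n + 1) t * χ t)) x =
      primitive (fun t => φ t * rad (n + 1) t) x * χ (i * P) := by
    intro i
    induction i with
    | zero => exact hstep 0 (by simp [primitive])
    | succ i ih =>
      refine hstep (i + 1) ?_
      have := primitive_mul_rad_nat h (i + 1)
      rw [← hP] at this
      push_cast at *
      rw [ih _ (by nlinarith) le_rfl, this, zero_mul]
  have hx1 := Nat.floor_le (mul_nonneg h2.le hx)
  have hx2 := Nat.lt_floor_add_one ((2 : ℝ) ^ n * x)
  have h1 : (⌊(2 : ℝ) ^ n * x⌋₊ : ℝ) * P ≤ x := by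
    rw [hP, ← div_eq_mul_inv, div_le_iff₀ h2]; linarith
  have h3 : x < (⌊(2 : ℝ) ^ n * x⌋₊ + 1) * P := by
    rw [hP, ← div_eq_mul_inv, lt_div_iff₀ h2]; linarith
  rw [main _ x h1 h3.le, hcell _ x h1 h3]

end Step

theorem primitive_congr_nonneg {φ ψ : ℝ → ℝ} (h : ∀ x, 0 ≤ x → φ x = ψ x) {x : ℝ} (hx : 0 ≤ x) :
    primitive φ x = primitive ψ x := by
  refine intervalIntegral.integral_congr fun t ht => h t ?_
  rw [uIcc_of_le hx] at ht
  exact ht.1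

/-- The iterated primitive of a product of Rademacher functions, of order the number of factors
at the finest scales, is a nonnegative periodic function times the remaining factors. -/
theorem exists_iterate_primitive_prod_rad (T : Finset ℕ) : ∀ n : ℕ, (∀ m ∈ T, n < m) →
    ∃ φ, DyadicPeriodic n (∏ m ∈ T, ((2 : ℝ) ^ m)⁻¹) φ ∧ ∀ χ, DyadicConst n χ →
      (∀ x, 0 ≤ x → primitive^[T.card] (fun t => (∏ m ∈ T, rad m t) * χ t) x = φ x * χ x) ∧
      ∀ i < T.card, primitive^[i + 1] (fun t => (∏ m ∈ T, rad m t) * χ t) 1 = 0 := by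
  -- Adding the smallest bit last means that the finest scales are integrated first, when every
  -- remaining factor is constant on the cells concerned.
  induction T using Finset.induction_on_min with
  | empty =>
    intro n _
    refine ⟨fun _ => 1, ⟨measurable_const, fun a b => intervalIntegrable_const, fun _ _ => zero_le_one,
      fun _ _ => by simp, fun _ _ => rfl⟩, fun χ _ => ⟨fun x _ => by simp, fun i hi => ?_⟩⟩
    simp at hi
  | insert a T ha ih =>
    intro n hn
    have hna := hn a (Finset.mem_insert_self a T)
    obtain ⟨b, rfl⟩ : ∃ b, a = b + 1 := ⟨a - 1, by omega⟩
    have haT : b + 1 ∉ T := fun h => lt_irrefl _ (ha _ h)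
    obtain ⟨φ, hφ, hχφ⟩ := ih (b + 1) ha
    refine ⟨primitive fun t => φ t * rad (b + 1) t, ?_, fun χ hχ => ?_⟩
    · rw [Finset.prod_insert haT]
      exact hφ.primitive_mul_rad.mono (by omega)
    · have hb : DyadicConst b χ := hχ.mono (by omega)
      -- While the finer bits are being integrated, the new bit `b + 1` counts as part of the
      -- locally constant factor.
      obtain ⟨h1, h2⟩ := hχφ _ ((dyadicConst_rad (b + 1)).mul (hb.mono b.le_succ))
      have he : (fun t => (∏ m ∈ insert (b + 1) T, rad m t) * χ t) =
          fun t => (∏ m ∈ T, rad m t) * (rad (b + 1) t * χ t) := by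
        funext t
        rw [Finset.prod_insert haT]
        ring
      have h3 : ∀ x, 0 ≤ x → primitive^[T.card + 1]
          (fun t => (∏ m ∈ T, rad m t) * (rad (b + 1) t * χ t)) x =
          primitive (fun t => φ t * rad (b + 1) t) x * χ x := by
        intro x hx
        rw [Function.iterate_succ_apply', primitive_congr_nonneg h1 hx,
          primitive_mul_rad_mul hφ hb hx]
      rw [he, Finset.card_insert_of_notMem haT]
      refine ⟨h3, fun i hi => ?_⟩
      rcases Nat.lt_succ_iff_lt_or_eq.1 hi with hi | rfl
      · exact h2 i hi
      -- The point `1` is `2 ^ b` full periods of length `2 ^ (-b)`, hence a zero of the last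
      -- primitive.
      · have h0 := primitive_mul_rad_nat hφ (2 ^ b)
        push_cast at h0
        rw [mul_inv_cancel₀ (by positivity)] at h0
        rw [h3 1 zero_le_one, h0, zero_mul]

end Walsh

/-! ### The fractional kernel against Walsh functions: row and column bounds. -/

section Kernel

/-- The truncated power `y ↦ y_+^(lam - 1)`. -/
noncomputable def truncPow (lam y : ℝ) : ℝ := fracKernel lam y 0

theorem fracKernel_eq_truncPow (lam x t : ℝ) : fracKernel lam x t = truncPow lam (x - t) := by
  simp [fracKernel, truncPow]

theorem truncPow_of_pos (lam : ℝ) {y : ℝ} (hy : 0 < y) : truncPow lam y = y ^ (lam - 1) := by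
  simp [truncPow, fracKernel, hy]

theorem truncPow_of_nonpos (lam : ℝ) {y : ℝ} (hy : y ≤ 0) : truncPow lam y = 0 := by
  simp [truncPow, fracKernel, hy.not_gt]

theorem truncPow_nonneg (lam y : ℝ) : 0 ≤ truncPow lam y := by
  rcases le_or_gt y 0 with h | h
  · rw [truncPow_of_nonpos lam h]
  · rw [truncPow_of_pos lam h]; positivity

theorem measurable_truncPow (lam : ℝ) : Measurable (truncPow lam) := by
  have : truncPow lam = indicator (Ioi 0) fun y => y ^ (lam - 1) := by
    funext y
    rcases le_or_gt y 0 with h | h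
    · rw [truncPow_of_nonpos lam h, indicator_of_notMem (by simpa using h)]
    · rw [truncPow_of_pos lam h, indicator_of_mem (by simpa using h)]
  rw [this]
  exact (by fun_prop : Measurable fun y : ℝ => y ^ (lam - 1)).indicator measurableSet_Ioi

variable {lam : ℝ}

theorem intervalIntegrable_truncPow (h0 : 0 < lam) (a b : ℝ) :
    IntervalIntegrable (truncPow lam) volume a b := by
  have h := intervalIntegral.intervalIntegrable_rpow' (a := a) (b := b) (r := lam - 1) (by linarith)
  refine h.mono_fun (measurable_truncPow lam).aestronglyMeasurable
    (Filter.Eventually.of_forall fun y => ?_)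
  beta_reduce
  rcases le_or_gt y 0 with hy | hy
  · rw [truncPow_of_nonpos lam hy]; simp
  · rw [truncPow_of_pos lam hy]

theorem integral_truncPow (h0 : 0 < lam) (b : ℝ) :
    ∫ y in (0 : ℝ)..b, truncPow lam y = (max b 0) ^ lam / lam := by
  rcases le_or_gt b 0 with hb | hb
  · rw [max_eq_right hb, Real.zero_rpow h0.ne', zero_div]
    have : ∫ y in (0 : ℝ)..b, truncPow lam y = ∫ y in (0 : ℝ)..b, (0 : ℝ) := by
      refine intervalIntegral.integral_congr fun y hy => ?_
      rw [uIcc_of_ge hb] at hy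
      exact truncPow_of_nonpos lam hy.2
    rw [this, intervalIntegral.integral_zero]
  · rw [max_eq_left hb.le]
    have : ∫ y in (0 : ℝ)..b, truncPow lam y = ∫ y in (0 : ℝ)..b, y ^ (lam - 1) := by
      refine intervalIntegral.integral_congr_uIoo fun y hy => ?_
      rw [uIoo_of_le hb.le] at hy
      exact truncPow_of_pos lam hy.1
    rw [this, integral_rpow (Or.inl (by linarith))]
    simp [Real.zero_rpow h0.ne']

/-- This is subadditivity of `t ↦ t ^ lam`, valid because `lam ≤ 1`: an interval of length `δ`
carries the most mass next to the singularity. -/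
theorem integral_truncPow_le (h0 : 0 < lam) (h1 : lam ≤ 1) (a : ℝ) {δ : ℝ} (hδ : 0 ≤ δ) :
    ∫ y in a..(a + δ), truncPow lam y ≤ δ ^ lam / lam := by
  rw [← intervalIntegral.integral_interval_sub_left (intervalIntegrable_truncPow h0 0 (a + δ))
    (intervalIntegrable_truncPow h0 0 a), integral_truncPow h0, integral_truncPow h0, ← sub_div]
  refine div_le_div_of_nonneg_right ?_ h0.le
  have hm : max (a + δ) 0 ≤ max a 0 + δ :=
    max_le (by gcongr; exact le_max_left _ _) (add_nonneg (le_max_right _ _) hδ)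
  have h2 : (max (a + δ) 0) ^ lam ≤ (max a 0 + δ) ^ lam :=
    Real.rpow_le_rpow (le_max_right _ _) hm h0.le
  have h3 := Real.rpow_add_le_add_rpow (le_max_right a 0) hδ h0.le h1
  linarith

/-- The fractional integral of a function over one half of a dyadic interval. -/
noncomputable def halfKernel (lam δ : ℝ) (φ : ℝ → ℝ) (y : ℝ) : ℝ :=
  ∫ x in (0 : ℝ)..δ, truncPow lam (x + y) * φ x

variable {δ M : ℝ} {φ : ℝ → ℝ}

theorem measurable_halfKernel (lam δ : ℝ) (hm : Measurable φ) :
    Measurable (halfKernel lam δ φ) :=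
  measurable_integral_zero_to (F := fun q : ℝ × ℝ => truncPow lam (q.2 + q.1) * φ q.2)
    (((measurable_truncPow lam).comp (measurable_snd.add measurable_fst)).mul
      (hm.comp measurable_snd)) measurable_const

/-- Measurable functions on the half-line with values in `[0, M]`. -/
structure NonnegBdd (M : ℝ) (φ : ℝ → ℝ) : Prop where
  measurable : Measurable φ
  nonneg : ∀ x, 0 ≤ x → 0 ≤ φ x
  le : ∀ x, 0 ≤ x → φ x ≤ M

theorem NonnegBdd.nonneg_bound (h : NonnegBdd M φ) : 0 ≤ M :=
  (h.nonneg 0 le_rfl).trans (h.le 0 le_rfl)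

theorem intervalIntegrable_truncPow_add (h0 : 0 < lam) (y a b : ℝ) :
    IntervalIntegrable (fun x => truncPow lam (x + y)) volume a b := by
  simpa using (intervalIntegrable_truncPow h0 (a + y) (b + y)).comp_add_right y

theorem NonnegBdd.intervalIntegrable_of_le (h : NonnegBdd M φ) (h0 : 0 < lam) {a b : ℝ}
    (ha : 0 ≤ a) (hab : a ≤ b) (y : ℝ) :
    IntervalIntegrable (fun x => truncPow lam (x + y) * φ x) volume a b := by
  have hi := intervalIntegrable_truncPow_add h0 y a b
  rw [intervalIntegrable_iff_integrableOn_Ioc_of_le hab] at *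
  refine hi.mul_bdd (c := M) h.measurable.aestronglyMeasurable ?_
  refine (ae_restrict_mem measurableSet_Ioc).mono fun x hx => ?_
  have hx0 : 0 ≤ x := ha.trans hx.1.le
  rw [Real.norm_of_nonneg (h.nonneg x hx0)]
  exact h.le x hx0

theorem NonnegBdd.intervalIntegrable (h : NonnegBdd M φ) (h0 : 0 < lam) (hδ : 0 ≤ δ) (y : ℝ) :
    IntervalIntegrable (fun x => truncPow lam (x + y) * φ x) volume 0 δ :=
  h.intervalIntegrable_of_le h0 le_rfl hδ y

theorem halfKernel_nonneg (h : NonnegBdd M φ) (hδ : 0 ≤ δ) (y : ℝ) :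
    0 ≤ halfKernel lam δ φ y :=
  intervalIntegral.integral_nonneg hδ fun x hx => mul_nonneg (truncPow_nonneg _ _) (h.nonneg x hx.1)

theorem halfKernel_le (h : NonnegBdd M φ) (h0 : 0 < lam) (h1 : lam ≤ 1) (hδ : 0 ≤ δ) (y : ℝ) :
    halfKernel lam δ φ y ≤ M * (δ ^ lam / lam) := by
  have hi := intervalIntegrable_truncPow_add h0 y 0 δ
  calc halfKernel lam δ φ y ≤ ∫ x in (0 : ℝ)..δ, M * truncPow lam (x + y) := by
        refine intervalIntegral.integral_mono_on hδ (h.intervalIntegrable h0 hδ y)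
          (hi.const_mul M) fun x hx => ?_
        rw [mul_comm]
        exact mul_le_mul_of_nonneg_right (h.le x hx.1) (truncPow_nonneg _ _)
    _ = M * ∫ x in y..(y + δ), truncPow lam x := by
        rw [intervalIntegral.integral_const_mul, intervalIntegral.integral_comp_add_right, zero_add,
          add_comm δ y]
    _ ≤ _ := mul_le_mul_of_nonneg_left (integral_truncPow_le h0 h1 y hδ) h.nonneg_bound

theorem halfKernel_eq_zero (hδ : 0 ≤ δ) {y : ℝ} (hy : y ≤ -δ) : halfKernel lam δ φ y = 0 := by
  have : halfKernel lam δ φ y = ∫ x in (0 : ℝ)..δ, (0 : ℝ) := by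
    refine intervalIntegral.integral_congr fun x hx => ?_
    rw [uIcc_of_le hδ] at hx
    rw [truncPow_of_nonpos lam (by linarith [hx.2]), zero_mul]
  rw [this, intervalIntegral.integral_zero]

theorem halfKernel_antitone (h : NonnegBdd M φ) (h0 : 0 < lam) (h1 : lam ≤ 1) (hδ : 0 ≤ δ)
    {y y' : ℝ} (hy : 0 ≤ y) (hyy : y ≤ y') : halfKernel lam δ φ y' ≤ halfKernel lam δ φ y := by
  refine intervalIntegral.integral_mono_on_of_le_Ioo hδ (h.intervalIntegrable h0 hδ y')
    (h.intervalIntegrable h0 hδ y) fun x hx => ?_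
  have hx0 : 0 < x := hx.1
  refine mul_le_mul_of_nonneg_right ?_ (h.nonneg x hx.1.le)
  rw [truncPow_of_pos lam (by linarith), truncPow_of_pos lam (by linarith)]
  exact Real.rpow_le_rpow_of_nonpos (by linarith) (by linarith) (by linarith)

theorem halfKernel_one (hδ : 0 ≤ δ) {y : ℝ} (hy : 0 ≤ y) :
    halfKernel 1 δ φ y = ∫ x in (0 : ℝ)..δ, φ x := by
  refine intervalIntegral.integral_congr_uIoo fun x hx => ?_
  rw [uIoo_of_le hδ] at hx
  have hx0 : 0 < x := hx.1
  rw [truncPow_of_pos 1 (by linarith), sub_self, Real.rpow_zero, one_mul]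

/-- The constant by which the sums of the kernels exceed a single one. -/
noncomputable def kernelConst (lam : ℝ) : ℝ := if lam < 1 then 2 else 1

theorem one_le_kernelConst (lam : ℝ) : 1 ≤ kernelConst lam := by
  unfold kernelConst; split_ifs <;> norm_num

/-- The difference of the kernels of the two halves of a dyadic interval. -/
noncomputable def diffKernel (lam δ : ℝ) (φ : ℝ → ℝ) (y : ℝ) : ℝ :=
  halfKernel lam δ φ y - halfKernel lam δ φ (y + δ)

theorem measurable_diffKernel (lam δ : ℝ) (hm : Measurable φ) :
    Measurable (diffKernel lam δ φ) :=
  (measurable_halfKernel lam δ hm).sub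
    ((measurable_halfKernel lam δ hm).comp (measurable_id.add measurable_const))

theorem abs_diffKernel_le (h : NonnegBdd M φ) (h0 : 0 < lam) (h1 : lam ≤ 1) (hδ : 0 ≤ δ) (y : ℝ) :
    |diffKernel lam δ φ y| ≤ M * (δ ^ lam / lam) := by
  have a1 := halfKernel_nonneg (lam := lam) h hδ y
  have a2 := halfKernel_nonneg (lam := lam) h hδ (y + δ)
  have b1 := halfKernel_le h h0 h1 hδ y
  have b2 := halfKernel_le h h0 h1 hδ (y + δ)
  rw [diffKernel, abs_le]
  constructor <;> linarith

theorem diffKernel_eq_zero (hδ : 0 ≤ δ) {y : ℝ} (hy : y ≤ -(2 * δ)) : diffKernel lam δ φ y = 0 := by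
  rw [diffKernel, halfKernel_eq_zero hδ (by linarith), halfKernel_eq_zero hδ (by linarith), sub_zero]

/-- For `lam < 1` the half kernel decreases on `y ≥ 0`, so the difference over a step `δ` is at most
that over `2 * δ`, which telescopes across cells. For `lam = 1` it is constant there and the
difference is zero; hence the smaller constant in that case. -/
theorem abs_diffKernel_le_sub (h : NonnegBdd M φ) (h0 : 0 < lam) (h1 : lam ≤ 1) (hδ : 0 ≤ δ)
    {y : ℝ} (hy : 0 ≤ y) : |diffKernel lam δ φ y| ≤ (kernelConst lam - 1) *
      (halfKernel lam δ φ y - halfKernel lam δ φ (y + 2 * δ)) := by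
  rcases h1.lt_or_eq with hl | rfl
  · have a1 := halfKernel_antitone h h0 h1 hδ hy (by linarith : y ≤ y + δ)
    have a2 := halfKernel_antitone h h0 h1 hδ (by linarith : 0 ≤ y + δ)
      (by linarith : y + δ ≤ y + 2 * δ)
    rw [kernelConst, if_pos hl, diffKernel, abs_of_nonneg (by linarith)]
    linarith
  · rw [diffKernel, halfKernel_one hδ hy, halfKernel_one hδ (by linarith),
      halfKernel_one hδ (by linarith)]
    simp

/-- Cells ending at or before `t` contribute nothing, the cell containing `t` contributes at most
`B`, and all later cells together telescope to at most `(A - 1) * B`. -/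
theorem sum_abs_diffKernel_le (h : NonnegBdd M φ) (h0 : 0 < lam) (h1 : lam ≤ 1) (hδ : 0 < δ)
    {t : ℝ} (ht : 0 ≤ t) (N : ℕ) :
    ∑ c ∈ Finset.range N, |diffKernel lam δ φ (c * (2 * δ) - t)| ≤
      kernelConst lam * (M * (δ ^ lam / lam)) := by
  set B := M * (δ ^ lam / lam)
  set A := kernelConst lam
  have hA : 1 ≤ A := one_le_kernelConst lam
  have hB : 0 ≤ B := (halfKernel_nonneg h hδ.le 0).trans (halfKernel_le h h0 h1 hδ.le 0)
  have hP : 0 < 2 * δ := by linarith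
  have hle := fun y => halfKernel_le (δ := δ) h h0 h1 hδ.le y
  have hnn := fun y => halfKernel_nonneg (lam := lam) h hδ.le y
  have main : ∀ N : ℕ, ((N : ℝ) * (2 * δ) ≤ t →
      ∑ c ∈ Finset.range N, |diffKernel lam δ φ (c * (2 * δ) - t)| = 0) ∧
      (t < N * (2 * δ) → ∑ c ∈ Finset.range N, |diffKernel lam δ φ (c * (2 * δ) - t)| ≤
        -- The subtracted term is the part of the telescoping budget still unspent after `N` cells.
        A * B - (A - 1) * halfKernel lam δ φ (N * (2 * δ) - t)) := by
    intro N
    induction N with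
    | zero => exact ⟨fun _ => by simp, fun hlt => by simp at hlt; linarith⟩
    | succ N ih =>
      rw [Finset.sum_range_succ]
      push_cast
      refine ⟨fun hN => ?_, fun hN => ?_⟩
      · rw [ih.1 (by linarith), diffKernel_eq_zero hδ.le (by linarith)]
        simp
      · rcases le_or_gt ((N : ℝ) * (2 * δ)) t with hc | hc
        · rw [ih.1 hc, zero_add]
          refine (abs_diffKernel_le h h0 h1 hδ.le _).trans ?_
          nlinarith [hle ((N + 1 : ℝ) * (2 * δ) - t)]
        · have e := abs_diffKernel_le_sub h h0 h1 hδ.le (by linarith : 0 ≤ N * (2 * δ) - t)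
          have e2 := ih.2 hc
          have e3 : (N : ℝ) * (2 * δ) - t + 2 * δ = (N + 1) * (2 * δ) - t := by ring
          rw [e3] at e
          linarith
  rcases le_or_gt ((N : ℝ) * (2 * δ)) t with hc | hc
  · rw [(main N).1 hc]; positivity
  · refine ((main N).2 hc).trans ?_
    have := mul_nonneg (by linarith : 0 ≤ A - 1) (hnn (N * (2 * δ) - t))
    linarith

/-- The continuous analogue in `t`, with `y = b - t`: zero for `y ≤ -2δ`, at most `B` on an interval
of length `2δ`, and for `y ≥ 0` the difference of two integrals of the half kernel over windows of
length `2δ`. -/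
theorem integral_abs_diffKernel_le (h : NonnegBdd M φ) (h0 : 0 < lam) (h1 : lam ≤ 1) (hδ : 0 < δ)
    {N c : ℕ} (hN : N * (2 * δ) = 1) (hc : c < N) :
    ∫ t in (0 : ℝ)..1, |diffKernel lam δ φ (c * (2 * δ) - t)| ≤
      2 * δ * (kernelConst lam * (M * (δ ^ lam / lam))) := by
  set B := M * (δ ^ lam / lam)
  set A := kernelConst lam
  have hA : 1 ≤ A := one_le_kernelConst lam
  have hle := fun y => halfKernel_le (δ := δ) h h0 h1 hδ.le y
  have hnn := fun y => halfKernel_nonneg (lam := lam) h hδ.le y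
  have hiH : ∀ a b, IntervalIntegrable (halfKernel lam δ φ) volume a b := by
    intro a b
    refine (intervalIntegrable_const (c := B)).mono_fun
      (measurable_halfKernel lam δ h.measurable).aestronglyMeasurable
      (Filter.Eventually.of_forall fun y => ?_)
    beta_reduce
    rw [Real.norm_of_nonneg (hnn y), Real.norm_of_nonneg ((hnn y).trans (hle y))]
    exact hle y
  have hiE : ∀ a b, IntervalIntegrable (fun y => |diffKernel lam δ φ y|) volume a b := by
    intro a b
    refine (intervalIntegrable_const (c := B)).mono_fun
      (measurable_diffKernel lam δ h.measurable).abs.aestronglyMeasurable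
      (Filter.Eventually.of_forall fun y => ?_)
    beta_reduce
    rw [Real.norm_of_nonneg (abs_nonneg _), Real.norm_of_nonneg ((hnn y).trans (hle y))]
    exact abs_diffKernel_le h h0 h1 hδ.le y
  have hiS : ∀ a b, IntervalIntegrable (fun y => halfKernel lam δ φ (y + 2 * δ)) volume a b := by
    intro a b
    refine (intervalIntegrable_const (c := B)).mono_fun
      ((measurable_halfKernel lam δ h.measurable).comp
        (measurable_id.add measurable_const)).aestronglyMeasurable
      (Filter.Eventually.of_forall fun y => ?_)
    beta_reduce
    rw [Real.norm_of_nonneg (hnn _), Real.norm_of_nonneg ((hnn y).trans (hle y))]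
    exact hle _
  have hc' : (c : ℝ) + 1 ≤ N := by exact_mod_cast hc
  set b : ℝ := c * (2 * δ) with hb
  have hb0 : 0 ≤ b := by positivity
  have hb1 : b - 1 ≤ -(2 * δ) := by nlinarith
  have e1 : ∫ t in (0 : ℝ)..1, |diffKernel lam δ φ (b - t)| =
      ∫ y in (b - 1)..b, |diffKernel lam δ φ y| := by
    rw [intervalIntegral.integral_comp_sub_left (fun y => |diffKernel lam δ φ y|) b, sub_zero]
  have i1 : ∫ y in (b - 1)..(-(2 * δ)), |diffKernel lam δ φ y| = 0 := by
    have : ∫ y in (b - 1)..(-(2 * δ)), |diffKernel lam δ φ y| =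
        ∫ y in (b - 1)..(-(2 * δ)), (0 : ℝ) := by
      refine intervalIntegral.integral_congr fun y hy => ?_
      rw [uIcc_of_le hb1] at hy
      rw [diffKernel_eq_zero hδ.le hy.2, abs_zero]
    rw [this, intervalIntegral.integral_zero]
  have i2 : ∫ y in (-(2 * δ))..0, |diffKernel lam δ φ y| ≤ 2 * δ * B := by
    have := intervalIntegral.integral_mono_on (by linarith : -(2 * δ) ≤ 0) (hiE _ _)
      (intervalIntegrable_const (μ := volume) (c := B))
      fun y _ => abs_diffKernel_le h h0 h1 hδ.le y
    simpa using this
  have i3 : ∫ y in (0 : ℝ)..b, |diffKernel lam δ φ y| ≤ (A - 1) * (2 * δ * B) := by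
    have m1 := intervalIntegral.integral_mono_on hb0 (hiE 0 b)
      (((hiH 0 b).sub (hiS 0 b)).const_mul (A - 1))
      fun y hy => abs_diffKernel_le_sub h h0 h1 hδ.le hy.1
    rw [intervalIntegral.integral_const_mul, intervalIntegral.integral_sub (hiH 0 b) (hiS 0 b),
      intervalIntegral.integral_comp_add_right (fun y => halfKernel lam δ φ y), zero_add,
      intervalIntegral.integral_interval_sub_interval_comm (hiH _ _) (hiH _ _) (hiH _ _)] at m1
    refine m1.trans (mul_le_mul_of_nonneg_left ?_ (by linarith))
    have m2 := intervalIntegral.integral_mono_on (by linarith : 0 ≤ 2 * δ) (hiH _ _)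
      (intervalIntegrable_const (μ := volume) (c := B)) fun y _ => hle y
    have m3 : 0 ≤ ∫ y in b..(b + 2 * δ), halfKernel lam δ φ y :=
      intervalIntegral.integral_nonneg (by linarith) fun y _ => hnn y
    simp only [intervalIntegral.integral_const, sub_zero, smul_eq_mul] at m2
    linarith
  rw [e1, ← intervalIntegral.integral_add_adjacent_intervals (hiE _ (-(2 * δ))) (hiE _ _), i1,
    ← intervalIntegral.integral_add_adjacent_intervals (hiE _ 0) (hiE _ _)]
  linarith

theorem DyadicPeriodic.nonnegBdd {n : ℕ} (h : DyadicPeriodic n M φ) : NonnegBdd M φ :=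
  ⟨h.measurable, h.nonneg, h.le⟩

theorem rad_add_mul (m : ℕ) {x : ℝ} (hx : 0 ≤ x) (k : ℕ) :
    rad m (x + k * ((2 : ℝ) ^ m)⁻¹) = (-1) ^ k * rad m x := by
  induction k with
  | zero => simp
  | succ k ih =>
    rw [Nat.cast_succ, add_mul, one_mul, ← add_assoc, rad_add (by positivity), ih, pow_succ]
    ring

theorem floor_two_pow_mul_add {m : ℕ} {x : ℝ} (hx : 0 ≤ x) (hx1 : x < ((2 : ℝ) ^ m)⁻¹) (k : ℕ) :
    ⌊(2 : ℝ) ^ m * (x + k * ((2 : ℝ) ^ m)⁻¹)⌋₊ = k := by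
  have h2 : (0 : ℝ) < (2 : ℝ) ^ m := by positivity
  rw [← one_div, lt_div_iff₀ h2] at hx1
  rw [mul_add, mul_left_comm, mul_inv_cancel₀ h2.ne', mul_one, Nat.floor_add_natCast (by positivity),
    Nat.floor_eq_zero.2 (by linarith), zero_add]

theorem sum_range_two_mul (f : ℕ → ℝ) (N : ℕ) :
    ∑ k ∈ Finset.range (2 * N), f k = ∑ c ∈ Finset.range N, (f (2 * c) + f (2 * c + 1)) := by
  induction N with
  | zero => simp
  | succ N ih =>
    rw [Nat.mul_succ, Finset.sum_range_succ, Finset.sum_range_succ, ih, Finset.sum_range_succ]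
    ring

/-- The fractional integral of a periodic function times a Rademacher function and a factor that is
constant on dyadic intervals. -/
theorem integral_fracKernel_mul {n : ℕ} (h : DyadicPeriodic (n + 1) M φ) (h0 : 0 < lam) {χ : ℝ → ℝ}
    (hχ : DyadicConst n χ) (t : ℝ) :
    ∫ x in (0 : ℝ)..1, fracKernel lam x t * (φ x * (rad (n + 1) x * χ x)) =
      ∑ c ∈ Finset.range (2 ^ n), χ (c * ((2 : ℝ) ^ n)⁻¹) *
        diffKernel lam ((2 : ℝ) ^ (n + 1))⁻¹ φ (c * (2 * ((2 : ℝ) ^ (n + 1))⁻¹) - t) := by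
  set δ : ℝ := ((2 : ℝ) ^ (n + 1))⁻¹ with hδ
  have hδ0 : 0 < δ := by positivity
  have h2δ : 2 * δ = ((2 : ℝ) ^ n)⁻¹ := by rw [hδ, pow_succ, mul_inv]; ring
  have hχ' := hχ.mono n.le_succ
  set F : ℝ → ℝ := fun x => fracKernel lam x t * (φ x * (rad (n + 1) x * χ x)) with hF
  have hi : ∀ a b : ℝ, 0 ≤ a → a ≤ b → IntervalIntegrable F volume a b := by
    intro a b ha hab
    have h3 := intervalIntegrable_mul_of_abs_le_one
      (intervalIntegrable_mul_of_abs_le_one (h.nonnegBdd.intervalIntegrable_of_le h0 ha hab (-t))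
        (measurable_rad (n + 1)) fun x => (abs_rad _ x).le) hχ.1 hχ.2
    refine h3.congr fun x _ => ?_
    simp only [hF, fracKernel_eq_truncPow, ← sub_eq_add_neg]
    ring
  have hcell : ∀ k : ℕ, ∫ x in (k * δ)..((k + 1 : ℕ) * δ), F x =
      (-1) ^ k * χ (k * δ) * halfKernel lam δ φ (k * δ - t) := by
    intro k
    have h4 := intervalIntegral.integral_comp_add_right (a := 0) (b := δ) F (k * δ)
    rw [zero_add] at h4
    rw [Nat.cast_succ, add_mul, one_mul, add_comm (k * δ), ← h4, halfKernel,
      ← intervalIntegral.integral_const_mul]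
    refine intervalIntegral.integral_congr_uIoo fun x hx => ?_
    rw [uIoo_of_le hδ0.le] at hx
    have e1 : χ (x + k * δ) = χ (k * δ) := by
      refine hχ'.const _ _ ?_
      have := floor_two_pow_mul_add (m := n + 1) le_rfl hδ0 k
      rw [zero_add] at this
      rw [floor_two_pow_mul_add hx.1.le hx.2, this]
    simp only [hF]
    rw [e1, fracKernel_eq_truncPow, h.period_mul k hx.1.le, rad_add_mul _ hx.1.le,
      rad_eq_one hx.2, add_sub_assoc]
    ring
  have hsum := intervalIntegral.sum_integral_adjacent_intervals (μ := volume) (f := F)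
    (a := fun k : ℕ => k * δ) (n := 2 * 2 ^ n) fun k _ =>
      hi _ _ (by positivity) (by push_cast; nlinarith)
  have hend : ((2 * 2 ^ n : ℕ) : ℝ) * δ = 1 := by
    push_cast
    rw [← pow_succ', mul_inv_cancel₀ (by positivity)]
  rw [hend, Nat.cast_zero, zero_mul] at hsum
  -- The two halves of a cell carry opposite Rademacher signs and the same value of `χ`; pairing
  -- them produces `diffKernel`.
  rw [← hsum, sum_range_two_mul]
  refine Finset.sum_congr rfl fun c _ => ?_
  rw [hcell, hcell, diffKernel, ← h2δ]
  have e2 : χ ((2 * c + 1 : ℕ) * δ) = χ (c * (2 * δ)) := by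
    refine hχ.const _ _ ?_
    have e3 := floor_two_pow_mul_add (m := n) hδ0.le
      (by rw [← h2δ]; linarith : δ < ((2 : ℝ) ^ n)⁻¹) c
    have e4 := floor_two_pow_mul_add (m := n) le_rfl (by positivity : 0 < ((2 : ℝ) ^ n)⁻¹) c
    rw [← h2δ] at e3 e4
    rw [zero_add] at e4
    rw [e4]
    convert e3 using 3
    push_cast
    ring
  have e5 : ((2 * c : ℕ) : ℝ) * δ = c * (2 * δ) := by push_cast; ring
  have e6 : ((2 * c + 1 : ℕ) : ℝ) * δ - t = c * (2 * δ) - t + δ := by push_cast; ring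
  rw [e2, e5, e6, pow_succ, pow_mul]
  simp only [even_two, Even.neg_pow, one_pow]
  ring

end Kernel

/-! ### Boundedness of fractional integrals and Fubini for them. -/

section FractionalIntegral

theorem measurable_fracKernel (lam : ℝ) : Measurable fun q : ℝ × ℝ => fracKernel lam q.1 q.2 := by
  simp only [fracKernel_eq_truncPow]
  exact (measurable_truncPow lam).comp (measurable_fst.sub measurable_snd)

theorem fracKernel_nonneg (lam x t : ℝ) : 0 ≤ fracKernel lam x t := by
  rw [fracKernel_eq_truncPow]; exact truncPow_nonneg _ _

variable {s : ℕ} {lam : ℝ} {p : ENNReal}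

/-- The kernel of the fractional integral in the variables belonging to `u`. -/
noncomputable def prodKernel (lam : ℝ) (u : Finset (Fin s)) (x t : Fin s → ℝ) : ℝ :=
  ∏ j, if j ∈ u then fracKernel lam (x j) (t j) else 1

theorem prodKernel_nonneg (lam : ℝ) (u : Finset (Fin s)) (x t : Fin s → ℝ) :
    0 ≤ prodKernel lam u x t :=
  Finset.prod_nonneg fun j _ => by
    split_ifs
    · exact fracKernel_nonneg _ _ _
    · exact zero_le_one

theorem measurable_prodKernel (lam : ℝ) (u : Finset (Fin s)) :
    Measurable fun q : (Fin s → ℝ) × (Fin s → ℝ) => prodKernel lam u q.1 q.2 := by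
  refine Finset.measurable_prod _ fun j _ => ?_
  by_cases h : j ∈ u
  · simp only [h, if_true]
    exact (measurable_fracKernel lam).comp (g := fun q : ℝ × ℝ => fracKernel lam q.1 q.2)
      (f := fun q : (Fin s → ℝ) × (Fin s → ℝ) => (q.1 j, q.2 j))
      (((measurable_pi_apply j).comp measurable_fst).prodMk
        ((measurable_pi_apply j).comp measurable_snd))
  · simp only [h, if_false]
    exact measurable_const

/-- Pulling each `D u` back along the projection from the full cube puts all terms on one
probability space, and measurable representatives can be chosen there. -/
theorem IsFracDeriv.exists_cubeMeasure_rep {g : (Fin s → ℝ) → ℝ}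
    {D : ∀ u : Finset (Fin s), (u → ℝ) → ℝ} (hD : IsFracDeriv lam p g D) :
    ∃ E : Finset (Fin s) → (Fin s → ℝ) → ℝ, (∀ u, Measurable (E u)) ∧
      (∀ u, MemLp (E u) p (cubeMeasure (Fin s))) ∧
      eLpNorm (E Finset.univ) 2 (cubeMeasure (Fin s)) = eLpNorm (D Finset.univ) 2
        (volume.restrict (cube (Finset.univ : Finset (Fin s)))) ∧
      ∀ x ∈ cube (Fin s), g x = ∑ u : Finset (Fin s), ((Real.Gamma lam) ^ u.card)⁻¹ *
        ∫ t, E u t * prodKernel lam u x t ∂cubeMeasure (Fin s) := by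
  obtain ⟨hp, hg⟩ := hD
  have hmp := fun u : Finset (Fin s) => measurePreserving_restrict_cube u
  have hp' : ∀ u, MemLp (fun x : Fin s → ℝ => D u fun j => x j) p (cubeMeasure (Fin s)) := by
    intro u
    have := hp u
    rw [volume_restrict_cube] at this
    exact this.comp_measurePreserving (hmp u)
  refine ⟨fun u => (hp' u).aestronglyMeasurable.mk _,
    fun u => (hp' u).aestronglyMeasurable.stronglyMeasurable_mk.measurable,
    fun u => (memLp_congr_ae (hp' u).aestronglyMeasurable.ae_eq_mk).1 (hp' u), ?_, fun x hx => ?_⟩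
  · rw [← eLpNorm_congr_ae (hp' Finset.univ).aestronglyMeasurable.ae_eq_mk, volume_restrict_cube]
    have := (hp Finset.univ).aestronglyMeasurable
    rw [volume_restrict_cube] at this
    exact eLpNorm_comp_measurePreserving this (hmp Finset.univ)
  · rw [hg x hx]
    refine Finset.sum_congr rfl fun u _ => ?_
    congr 1
    rw [volume_restrict_cube, ← (hmp u).map_eq, integral_map (hmp u).measurable.aemeasurable]
    · refine integral_congr_ae ?_
      filter_upwards [(hp' u).aestronglyMeasurable.ae_eq_mk] with t ht
      rw [← ht, prodKernel, Finset.prod_ite_mem, Finset.univ_inter,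
        Finset.prod_coe_sort u (fun j => fracKernel lam (x j) (t j))]
    · rw [(hmp u).map_eq]
      have := (hp u).aestronglyMeasurable
      rw [volume_restrict_cube] at this
      refine this.mul (Measurable.aestronglyMeasurable ?_)
      exact Finset.measurable_prod _ fun j _ => (measurable_fracKernel lam).comp
        (measurable_const.prodMk (measurable_pi_apply j))

/-- A power of the kernel is again a truncated power, of another order; this evaluates the dual norm
in Hölder's inequality. -/
theorem fracKernel_rpow {q : ℝ} (hq : 0 < q) (x t : ℝ) :
    fracKernel lam x t ^ q = truncPow ((lam - 1) * q + 1) (x - t) := by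
  rw [fracKernel_eq_truncPow]
  rcases le_or_gt (x - t) 0 with h | h
  · rw [truncPow_of_nonpos _ h, truncPow_of_nonpos _ h, Real.zero_rpow hq.ne']
  · rw [truncPow_of_pos _ h, truncPow_of_pos _ h, ← Real.rpow_mul h.le, add_sub_cancel_right]

theorem integrable_truncPow_sub (h0 : 0 < lam) (x : ℝ) :
    Integrable (fun t => truncPow lam (x - t)) unitMeasure := by
  have h := (intervalIntegrable_truncPow h0 (x - 0) (x - 1)).comp_sub_left x
  simp only [sub_sub_cancel] at h
  rw [intervalIntegrable_iff_integrableOn_Icc_of_le zero_le_one] at h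
  exact h

theorem integral_truncPow_sub_le (h0 : 0 < lam) {x : ℝ} (hx : x ∈ Icc (0 : ℝ) 1) :
    ∫ t, truncPow lam (x - t) ∂unitMeasure ≤ 1 / lam := by
  rw [unitMeasure, integral_Icc_eq_integral_Ioc, ← intervalIntegral.integral_of_le zero_le_one,
    intervalIntegral.integral_comp_sub_left (fun y => truncPow lam y), sub_zero,
    ← intervalIntegral.integral_interval_sub_left (intervalIntegrable_truncPow h0 0 x)
    (intervalIntegrable_truncPow h0 0 (x - 1)), integral_truncPow h0, integral_truncPow h0,
    max_eq_left hx.1, max_eq_right (by linarith [hx.2]), Real.zero_rpow h0.ne', zero_div, sub_zero]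
  exact div_le_div_of_nonneg_right (Real.rpow_le_one hx.1 hx.2 h0.le) h0.le

/-- There is a finite exponent `r` with `1 / lam < r ≤ p`. -/
theorem exists_exponent (h0 : 0 < lam) (h1 : lam ≤ 1) (hp : ENNReal.ofReal lam⁻¹ < p) :
    ∃ r : ℝ, 1 < r ∧ 1 < lam * r ∧ ENNReal.ofReal r ≤ p := by
  obtain ⟨r, hr0, hr1, hr2⟩ := ENNReal.lt_iff_exists_real_btwn.1 hp
  have h3 : lam⁻¹ < r := (ENNReal.ofReal_lt_ofReal_iff_of_nonneg (by positivity)).1 hr1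
  have h4 : 1 < lam * r := by
    rw [inv_lt_iff_one_lt_mul₀ h0] at h3
    linarith
  exact ⟨r, by nlinarith, h4, hr2.le⟩

/-- Hölder's inequality for the fractional integral, uniformly in the cube. -/
theorem exists_bound_prodKernel (h0 : 0 < lam) (h1 : lam ≤ 1) (hp : ENNReal.ofReal lam⁻¹ < p)
    {E : (Fin s → ℝ) → ℝ} (hm : Measurable E) (hE : MemLp E p (cubeMeasure (Fin s)))
    (u : Finset (Fin s)) : ∃ C, ∀ x ∈ cube (Fin s),
      Integrable (fun t => E t * prodKernel lam u x t) (cubeMeasure (Fin s)) ∧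
      ∫ t, ‖E t * prodKernel lam u x t‖ ∂cubeMeasure (Fin s) ≤ C := by
  obtain ⟨r, hr1, hr2, hr3⟩ := exists_exponent h0 h1 hp
  set q := r.conjExponent with hqdef
  have hpq : r.HolderConjugate q := Real.HolderConjugate.conjExponent hr1
  have hq0 : 0 < q := hpq.symm.pos
  set mu := (lam - 1) * q + 1 with hmu
  -- Here `mu = (lam * r - 1) / (r - 1)`, so the condition `1 < lam * r` is exactly what makes the
  -- `q`-th power of the kernel integrable.
  have hmu0 : 0 < mu := by
    have hq : q = r / (r - 1) := rfl
    have hr : 0 < r - 1 := by linarith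
    rw [hmu, hq, ← mul_div_assoc, div_add_one hr.ne']
    exact div_pos (by nlinarith) hr
  have hEr := hE.mono_exponent hr3
  have hEi : Integrable (fun t => |E t| ^ r) (cubeMeasure (Fin s)) := by
    have := hEr.integrable_norm_rpow (by simpa using by linarith) ENNReal.ofReal_ne_top
    rw [ENNReal.toReal_ofReal (by linarith)] at this
    exact this
  have hKq : ∀ x t : Fin s → ℝ, prodKernel lam u x t ^ q =
      ∏ j, if j ∈ u then truncPow mu (x j - t j) else 1 := by
    intro x t
    rw [prodKernel, ← Real.finsetProd_rpow _ _ fun j _ => by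
      split_ifs
      · exact fracKernel_nonneg _ _ _
      · exact zero_le_one]
    refine Finset.prod_congr rfl fun j _ => ?_
    split_ifs
    · exact fracKernel_rpow hq0 _ _
    · exact Real.one_rpow q
  have hone : ∀ (x : Fin s → ℝ) (j : Fin s), Integrable
      (fun t => if j ∈ u then truncPow mu (x j - t) else 1) unitMeasure := by
    intro x j
    by_cases hj : j ∈ u
    · simpa only [hj, if_true] using integrable_truncPow_sub hmu0 (x j)
    · simp only [hj, if_false]
      exact integrable_const 1
  have hKi : ∀ x : Fin s → ℝ,
      Integrable (fun t => prodKernel lam u x t ^ q) (cubeMeasure (Fin s)) := by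
    intro x
    simp only [hKq]
    exact Integrable.fintype_prod_dep (hone x)
  have hKle : ∀ x ∈ cube (Fin s), ∫ t, prodKernel lam u x t ^ q ∂cubeMeasure (Fin s) ≤
      ∏ j : Fin s, if j ∈ u then 1 / mu else 1 := by
    intro x hx
    simp only [hKq]
    rw [integral_fintype_prod_eq_prod (fun j t => if j ∈ u then truncPow mu (x j - t) else 1)]
    refine Finset.prod_le_prod (fun j _ => integral_nonneg fun t => ?_) fun j _ => ?_
    · simp only [Pi.zero_apply]
      split_ifs
      · exact truncPow_nonneg _ _
      · exact zero_le_one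
    · by_cases hj : j ∈ u
      · simpa only [hj, if_true] using integral_truncPow_sub_le hmu0 (mem_cube.1 hx j)
      · simp [hj]
  refine ⟨(∫ t, |E t| ^ r ∂cubeMeasure (Fin s)) / r +
    (∏ j : Fin s, if j ∈ u then 1 / mu else 1) / q, fun x hx => ?_⟩
  have hdom : Integrable (fun t => |E t| ^ r / r + prodKernel lam u x t ^ q / q)
    (cubeMeasure (Fin s)) := (hEi.div_const r).add ((hKi x).div_const q)
  -- Young's inequality pointwise yields the integrability and the uniform bound at the same time.
  have hle : ∀ t, ‖E t * prodKernel lam u x t‖ ≤ |E t| ^ r / r + prodKernel lam u x t ^ q / q := by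
    intro t
    rw [norm_mul, Real.norm_eq_abs, Real.norm_of_nonneg (prodKernel_nonneg _ _ _ _)]
    exact Real.young_inequality_of_nonneg (abs_nonneg _) (prodKernel_nonneg _ _ _ _) hpq
  have hint : Integrable (fun t => E t * prodKernel lam u x t) (cubeMeasure (Fin s)) :=
    hdom.mono' (hm.mul ((measurable_prodKernel lam u).comp
      (measurable_const.prodMk measurable_id))).aestronglyMeasurable
      (Filter.Eventually.of_forall hle)
  refine ⟨hint, (integral_mono hint.norm hdom hle).trans ?_⟩
  rw [integral_add (hEi.div_const r) ((hKi x).div_const q), integral_div, integral_div]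
  gcongr
  exact hKle x hx

/-- The fractional integral of `E` in the variables belonging to `u`. -/
noncomputable def fracIntegral (lam : ℝ) (E : (Fin s → ℝ) → ℝ) (u : Finset (Fin s))
    (x : Fin s → ℝ) : ℝ := ∫ t, E t * prodKernel lam u x t ∂cubeMeasure (Fin s)

theorem bddMeas_fracIntegral (h0 : 0 < lam) (h1 : lam ≤ 1) (hp : ENNReal.ofReal lam⁻¹ < p)
    {E : (Fin s → ℝ) → ℝ} (hm : Measurable E) (hE : MemLp E p (cubeMeasure (Fin s)))
    (u : Finset (Fin s)) : BddMeas (fracIntegral lam E u) := by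
  obtain ⟨C, hC⟩ := exists_bound_prodKernel h0 h1 hp hm hE u
  refine ⟨?_, C, fun x hx => (norm_integral_le_integral_norm _).trans (hC x hx).2⟩
  exact (StronglyMeasurable.integral_prod_right'
    (f := fun q : (Fin s → ℝ) × (Fin s → ℝ) => E q.2 * prodKernel lam u q.1 q.2)
    ((hm.comp measurable_snd).mul (measurable_prodKernel lam u)).stronglyMeasurable).measurable

theorem integral_fracIntegral_mul (h0 : 0 < lam) (h1 : lam ≤ 1) (hp : ENNReal.ofReal lam⁻¹ < p)
    {E : (Fin s → ℝ) → ℝ} (hm : Measurable E) (hE : MemLp E p (cubeMeasure (Fin s)))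
    (u : Finset (Fin s)) {v : Fin s → ℝ → ℝ} (hv : ∀ j, BddMeasUnit (v j)) :
    ∫ x, fracIntegral lam E u x * ∏ j, v j (x j) ∂cubeMeasure (Fin s) =
      ∫ t, E t * ∏ j, ∫ x, (if j ∈ u then fracKernel lam x (t j) else 1) * v j x ∂unitMeasure
        ∂cubeMeasure (Fin s) := by
  obtain ⟨C, hC⟩ := exists_bound_prodKernel h0 h1 hp hm hE u
  obtain ⟨hVm, V, hV⟩ := BddMeas.prod_comp hv
  have hmeas : Measurable fun q : (Fin s → ℝ) × (Fin s → ℝ) => E q.2 * prodKernel lam u q.1 q.2 :=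
    (hm.comp measurable_snd).mul (measurable_prodKernel lam u)
  have hi : Integrable (fun q : (Fin s → ℝ) × (Fin s → ℝ) => E q.2 * prodKernel lam u q.1 q.2)
      ((cubeMeasure (Fin s)).prod (cubeMeasure (Fin s))) := by
    rw [integrable_prod_iff hmeas.aestronglyMeasurable]
    refine ⟨ae_mem_cube.mono fun x hx => (hC x hx).1, ?_⟩
    refine Integrable.of_bound (hmeas.norm.stronglyMeasurable.integral_prod_right').aestronglyMeasurable
      C (ae_mem_cube.mono fun x hx => ?_)
    rw [Real.norm_of_nonneg (integral_nonneg fun t => norm_nonneg _)]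
    exact (hC x hx).2
  have hi2 : Integrable (fun q : (Fin s → ℝ) × (Fin s → ℝ) =>
      E q.2 * prodKernel lam u q.1 q.2 * ∏ j, v j (q.1 j))
      ((cubeMeasure (Fin s)).prod (cubeMeasure (Fin s))) := by
    refine hi.mul_bdd (c := V) (hVm.comp measurable_fst).aestronglyMeasurable ?_
    exact (Measure.quasiMeasurePreserving_fst.ae ae_mem_cube).mono fun q hq => hV _ hq
  have hswap := integral_integral_swap (f := fun x t =>
    E t * prodKernel lam u x t * ∏ j, v j (x j)) hi2
  calc _ = ∫ x, ∫ t, E t * prodKernel lam u x t * ∏ j, v j (x j) ∂cubeMeasure (Fin s)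
        ∂cubeMeasure (Fin s) := by
        simp only [fracIntegral, integral_mul_const]
    _ = _ := by
        rw [hswap]
        congr 1
        funext t
        simp only [mul_assoc, prodKernel, ← Finset.prod_mul_distrib, integral_const_mul]
        rw [integral_fintype_prod_eq_prod
          (fun j x => (if j ∈ u then fracKernel lam x (t j) else 1) * v j x)]

/-- In a variable outside `u` there is no kernel, so after Fubini that factor is the mean of `v j`,
which is zero. -/
theorem integral_fracIntegral_mul_eq_zero (h0 : 0 < lam) (h1 : lam ≤ 1)
    (hp : ENNReal.ofReal lam⁻¹ < p) {E : (Fin s → ℝ) → ℝ} (hm : Measurable E)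
    (hE : MemLp E p (cubeMeasure (Fin s))) {u : Finset (Fin s)} (hu : u ≠ Finset.univ)
    {v : Fin s → ℝ → ℝ} (hv : ∀ j, BddMeasUnit (v j)) (hv0 : ∀ j, ∫ x, v j x ∂unitMeasure = 0) :
    ∫ x, fracIntegral lam E u x * ∏ j, v j (x j) ∂cubeMeasure (Fin s) = 0 := by
  obtain ⟨j, hj⟩ : ∃ j, j ∉ u := by
    by_contra! h
    exact hu (Finset.eq_univ_iff_forall.2 h)
  rw [integral_fracIntegral_mul h0 h1 hp hm hE u hv]
  refine integral_eq_zero_of_ae (Filter.Eventually.of_forall fun t => ?_)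
  simp only [Pi.zero_apply]
  rw [Finset.prod_eq_zero (Finset.mem_univ j), mul_zero]
  simp [hj, hv0 j]

end FractionalIntegral

/-! ### Orthogonality of the discrete Walsh functions. -/

section Orthogonality

theorem rad_dyadic {m n : ℕ} (h : m ≤ n) (c : ℕ) :
    rad m (c * ((2 : ℝ) ^ n)⁻¹) = (-1) ^ (c / 2 ^ (n - m)) := by
  have e := floor_two_pow_mul_add (m := n) le_rfl (by positivity : 0 < ((2 : ℝ) ^ n)⁻¹) c
  rw [zero_add] at e
  rw [rad, floor_two_pow_mul h, e]

/-- The sum over all `S` is the expansion of `∏ (1 + rad m * rad m)` taken at the two points. A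
binary digit in which `c` and `d` differ gives a zero factor; if there is none, every factor is `2`.
-/
theorem sum_prod_rad_mul_prod_rad {n c d : ℕ} (hc : c < 2 ^ n) (hd : d < 2 ^ n) :
    ∑ S ∈ (Finset.Icc 1 n).powerset, (∏ m ∈ S, rad m (c * ((2 : ℝ) ^ n)⁻¹)) *
      ∏ m ∈ S, rad m (d * ((2 : ℝ) ^ n)⁻¹) = if c = d then (2 : ℝ) ^ n else 0 := by
  simp only [← Finset.prod_mul_distrib]
  rw [← Finset.prod_one_add]
  split_ifs with h
  · subst h
    have : ∀ m ∈ Finset.Icc 1 n, 1 + rad m (c * ((2 : ℝ) ^ n)⁻¹) * rad m (c * ((2 : ℝ) ^ n)⁻¹) =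
        2 := by
      intro m _
      rw [← abs_mul_abs_self, abs_rad]
      norm_num
    rw [Finset.prod_congr rfl this]
    simp
  · by_contra hne
    rw [← ne_eq, Finset.prod_ne_zero_iff] at hne
    refine h (Nat.eq_of_testBit_eq fun i => ?_)
    rcases lt_or_ge i n with hi | hi
    · have h1 := hne (n - i) (Finset.mem_Icc.2 ⟨by omega, by omega⟩)
      rw [rad_dyadic (by omega), rad_dyadic (by omega), ← pow_add, Nat.sub_sub_self hi.le] at h1
      have h2 : Even (c / 2 ^ i + d / 2 ^ i) := by
        by_contra hodd
        rw [Nat.not_even_iff_odd] at hodd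
        rw [hodd.neg_one_pow] at h1
        norm_num at h1
      rw [Nat.even_add, Nat.even_iff, Nat.even_iff] at h2
      rw [Nat.testBit_eq_decide_div_mod_eq, Nat.testBit_eq_decide_div_mod_eq]
      congr 1
      simp only [eq_iff_iff]
      omega
    · rw [Nat.testBit_lt_two_pow (hc.trans_le (Nat.pow_le_pow_right two_pos hi)),
        Nat.testBit_lt_two_pow (hd.trans_le (Nat.pow_le_pow_right two_pos hi))]

variable {s : ℕ}

/-- The multivariate discrete Walsh transform preserves the sum of squares up to a constant. -/
theorem sum_sq_discreteWalsh (n : Fin s → ℕ) (A : (Fin s → ℕ) → ℝ) :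
    ∑ S ∈ Fintype.piFinset fun j => (Finset.Icc 1 (n j)).powerset,
      (∑ c ∈ Fintype.piFinset fun j => Finset.range (2 ^ n j),
        (∏ j, ∏ m ∈ S j, rad m (c j * ((2 : ℝ) ^ n j)⁻¹)) * A c) ^ 2 =
      (∏ j, (2 : ℝ) ^ n j) * ∑ c ∈ Fintype.piFinset fun j => Finset.range (2 ^ n j), A c ^ 2 := by
  simp only [sq, Finset.sum_mul_sum]
  rw [Finset.sum_comm, Finset.mul_sum]
  refine Finset.sum_congr rfl fun c hc => ?_
  rw [Finset.sum_comm]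
  have key : ∀ d ∈ Fintype.piFinset fun j => Finset.range (2 ^ n j),
      ∑ S ∈ Fintype.piFinset fun j => (Finset.Icc 1 (n j)).powerset,
        (∏ j, ∏ m ∈ S j, rad m (c j * ((2 : ℝ) ^ n j)⁻¹)) * A c *
        ((∏ j, ∏ m ∈ S j, rad m (d j * ((2 : ℝ) ^ n j)⁻¹)) * A d) =
      if c = d then (∏ j, (2 : ℝ) ^ n j) * (A c * A d) else 0 := by
    intro d hd
    rw [Fintype.mem_piFinset] at hc hd
    have e : ∑ S ∈ Fintype.piFinset fun j => (Finset.Icc 1 (n j)).powerset,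
        ∏ j, ((∏ m ∈ S j, rad m (c j * ((2 : ℝ) ^ n j)⁻¹)) *
          ∏ m ∈ S j, rad m (d j * ((2 : ℝ) ^ n j)⁻¹)) =
        ∏ j, if c j = d j then (2 : ℝ) ^ n j else 0 := by
      rw [← Finset.prod_univ_sum (fun j => (Finset.Icc 1 (n j)).powerset)
        (fun j S => (∏ m ∈ S, rad m (c j * ((2 : ℝ) ^ n j)⁻¹)) *
          ∏ m ∈ S, rad m (d j * ((2 : ℝ) ^ n j)⁻¹))]
      exact Finset.prod_congr rfl fun j _ => sum_prod_rad_mul_prod_rad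
        (Finset.mem_range.1 (hc j)) (Finset.mem_range.1 (hd j))
    have e2 : (∏ j, if c j = d j then (2 : ℝ) ^ n j else 0) =
        if c = d then ∏ j, (2 : ℝ) ^ n j else 0 := by
      split_ifs with h
      · subst h; simp
      · obtain ⟨j, hj⟩ := Function.ne_iff.1 h
        exact Finset.prod_eq_zero (Finset.mem_univ j) (if_neg hj)
    rw [e2] at e
    calc _ = (∑ S ∈ Fintype.piFinset fun j => (Finset.Icc 1 (n j)).powerset,
        ∏ j, ((∏ m ∈ S j, rad m (c j * ((2 : ℝ) ^ n j)⁻¹)) *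
          ∏ m ∈ S j, rad m (d j * ((2 : ℝ) ^ n j)⁻¹))) * (A c * A d) := by
          rw [Finset.sum_mul]
          refine Finset.sum_congr rfl fun S _ => ?_
          rw [Finset.prod_mul_distrib]
          ring
      _ = _ := by rw [e]; split_ifs <;> ring
  rw [Finset.sum_congr rfl key, Finset.sum_ite_eq, if_pos hc]

end Orthogonality

/-! ### Schur's test. -/

section Schur

/-- Cauchy–Schwarz with weight `|k|`, read off from the discriminant of the nonnegative quadratic `a
↦ ∫ |k| * (a - sign k * E) ^ 2`. -/
theorem sq_integral_mul_le {X : Type*} [MeasurableSpace X] {μ : Measure X} {E k : X → ℝ}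
    (h1 : Integrable (fun t => E t ^ 2 * |k t|) μ) (h2 : Integrable (fun t => E t * k t) μ)
    (h3 : Integrable k μ) :
    (∫ t, E t * k t ∂μ) ^ 2 ≤ (∫ t, |k t| ∂μ) * ∫ t, E t ^ 2 * |k t| ∂μ := by
  have key : ∀ a : ℝ, 0 ≤ (∫ t, |k t| ∂μ) * (a * a) + (-2 * ∫ t, E t * k t ∂μ) * a +
      ∫ t, E t ^ 2 * |k t| ∂μ := by
    intro a
    have e : ∫ t, (|k t| * (a * a) + (-2 * a) * (E t * k t) + E t ^ 2 * |k t|) ∂μ =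
        (∫ t, |k t| ∂μ) * (a * a) + (-2 * ∫ t, E t * k t ∂μ) * a + ∫ t, E t ^ 2 * |k t| ∂μ := by
      rw [integral_add (f := fun t => |k t| * (a * a) + (-2 * a) * (E t * k t))
        ((h3.abs.mul_const _).add (h2.const_mul _)) h1, integral_add (h3.abs.mul_const _) (h2.const_mul _), integral_mul_const, integral_const_mul]
      ring
    rw [← e]
    refine integral_nonneg fun t => ?_
    simp only [Pi.zero_apply]
    rcases abs_cases (k t) with ⟨h, h'⟩ | ⟨h, h'⟩
    · rw [h]
      nlinarith [mul_nonneg h' (sq_nonneg (E t - a))]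
    · rw [h]
      nlinarith [mul_nonneg (neg_pos.2 h').le (sq_nonneg (E t + a))]
  have := discrim_le_zero key
  rw [discrim] at this
  linarith

variable {s : ℕ}

/-- Schur's test for a product of univariate kernels. -/
theorem sum_sq_integral_prod_kernel_le {E : (Fin s → ℝ) → ℝ}
    (hE2 : MemLp E 2 (cubeMeasure (Fin s))) (N : Fin s → ℕ) {K : Fin s → ℕ → ℝ → ℝ}
    (hK : ∀ j c, Measurable (K j c)) {a b : Fin s → ℝ}
    (ha : ∀ j, ∀ t ∈ Icc (0 : ℝ) 1, ∑ c ∈ Finset.range (N j), |K j c t| ≤ a j)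
    (hb0 : ∀ j, 0 ≤ b j) (hb : ∀ j, ∀ c < N j, ∫ t, |K j c t| ∂unitMeasure ≤ b j) :
    ∑ c ∈ Fintype.piFinset fun j => Finset.range (N j),
      (∫ t, E t * ∏ j, K j (c j) (t j) ∂cubeMeasure (Fin s)) ^ 2 ≤
      (∏ j, b j) * ((∏ j, a j) * ∫ t, E t ^ 2 ∂cubeMeasure (Fin s)) := by
  have hEi : Integrable E (cubeMeasure (Fin s)) := hE2.integrable (by norm_num)
  have hEsq : Integrable (fun t => E t ^ 2) (cubeMeasure (Fin s)) := hE2.integrable_sq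
  have hKb : ∀ j, ∀ c ∈ Finset.range (N j), BddMeasUnit (K j c) := fun j c hc =>
    ⟨hK j c, a j, fun t ht => (Finset.single_le_sum (f := fun c => |K j c t|)
      (fun _ _ => abs_nonneg _) hc).trans (ha j t ht)⟩
  have hkb : ∀ c ∈ Fintype.piFinset fun j => Finset.range (N j),
      BddMeas (fun t : Fin s → ℝ => ∏ j, K j (c j) (t j)) := fun c hc =>
    BddMeas.prod_comp fun j => hKb j (c j) (Fintype.mem_piFinset.1 hc j)
  have hmul : ∀ {F k : (Fin s → ℝ) → ℝ}, Integrable F (cubeMeasure (Fin s)) → BddMeas k →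
      Integrable (fun t => F t * k t) (cubeMeasure (Fin s)) := by
    rintro F k hF ⟨hm, M, hM⟩
    exact hF.mul_bdd (c := M) hm.aestronglyMeasurable (ae_mem_cube.mono hM)
  have habs : ∀ {k : (Fin s → ℝ) → ℝ}, BddMeas k → BddMeas (fun t => |k t|) := by
    rintro k ⟨hm, M, hM⟩
    exact ⟨hm.abs, M, fun x hx => by rw [abs_abs]; exact hM x hx⟩
  have hbnn : ∀ c ∈ Fintype.piFinset fun j => Finset.range (N j),
      ∫ t, |∏ j, K j (c j) (t j)| ∂cubeMeasure (Fin s) ≤ ∏ j, b j := by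
    intro c hc
    simp only [Finset.abs_prod]
    rw [integral_fintype_prod_eq_prod (fun j t => |K j (c j) t|)]
    exact Finset.prod_le_prod (fun j _ => integral_nonneg fun t => abs_nonneg _) fun j _ =>
      hb j (c j) (Finset.mem_range.1 (Fintype.mem_piFinset.1 hc j))
  have hstep : ∀ c ∈ Fintype.piFinset fun j => Finset.range (N j),
      (∫ t, E t * ∏ j, K j (c j) (t j) ∂cubeMeasure (Fin s)) ^ 2 ≤
      (∏ j, b j) * ∫ t, E t ^ 2 * |∏ j, K j (c j) (t j)| ∂cubeMeasure (Fin s) := by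
    intro c hc
    refine (sq_integral_mul_le (hmul hEsq (habs (hkb c hc))) (hmul hEi (hkb c hc))
      (hkb c hc).integrable).trans ?_
    exact mul_le_mul_of_nonneg_right (hbnn c hc)
      (integral_nonneg fun t => mul_nonneg (sq_nonneg _) (abs_nonneg _))
  refine (Finset.sum_le_sum hstep).trans ?_
  rw [← Finset.mul_sum]
  refine mul_le_mul_of_nonneg_left ?_ (Finset.prod_nonneg fun j _ => hb0 j)
  rw [← integral_finsetSum _ fun c hc => hmul hEsq (habs (hkb c hc)), ← integral_const_mul]
  refine integral_mono_ae (integrable_finsetSum _ fun c hc => hmul hEsq (habs (hkb c hc)))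
    (hEsq.const_mul _) (ae_mem_cube.mono fun t ht => ?_)
  simp only [← Finset.mul_sum, Finset.abs_prod]
  -- The sum over multi-indices factors into univariate row sums, each bounded by `a j`.
  rw [← Finset.prod_univ_sum (fun j => Finset.range (N j)) (fun j c => |K j c (t j)|), mul_comm]
  exact mul_le_mul_of_nonneg_right (Finset.prod_le_prod (fun j _ => Finset.sum_nonneg
    fun _ _ => abs_nonneg _) fun j _ => ha j _ (mem_cube.1 ht j)) (sq_nonneg _)

end Schur

/-! ### Splitting the set of nonzero bits at one position. -/

section Bits

theorem mem_nonzeroBits {k m : ℕ} :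
    m ∈ nonzeroBits k ↔ 1 ≤ m ∧ k.testBit (m - 1) = true := by
  rw [nonzeroBits, Finset.mem_filter, Finset.mem_Icc]
  refine ⟨fun h => ⟨h.1.1, h.2⟩, fun h => ⟨⟨h.1, ?_⟩, h.2⟩⟩
  have := Nat.lt_size.2 (Nat.ge_two_pow_of_testBit h.2)
  omega

theorem nonzeroBits_injective : Function.Injective nonzeroBits := by
  intro k k' h
  refine Nat.eq_of_testBit_eq fun i => ?_
  have := Finset.ext_iff.1 h (i + 1)
  rw [mem_nonzeroBits, mem_nonzeroBits] at this
  simp only [Nat.le_add_left, Nat.add_sub_cancel, true_and] at this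
  exact Bool.eq_iff_iff.2 this

/-- Since `l ≥ 1`, the value is not the default `0`, so the decreasing list really has an entry at
index `q`; the elements above it are its first `q` entries. -/
theorem qthLargest_spec {κ : Finset ℕ} {q l : ℕ} (h : qthLargest κ (q + 1) = l) (hl : 1 ≤ l) :
    l ∈ κ ∧ (κ.filter fun m => l < m).card = q := by
  set L := κ.sort (fun a b => a ≥ b) with hL
  have hs : L.SortedGT := κ.sortedGT_sort
  rw [qthLargest, Nat.add_sub_cancel, ← hL] at h
  have hq : q < L.length := by
    by_contra hq
    rw [List.getD_eq_default _ _ (by omega)] at h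
    omega
  rw [List.getD_eq_getElem _ _ hq] at h
  have hmem : ∀ m, m ∈ L ↔ m ∈ κ := fun m => Finset.mem_sort _
  refine ⟨(hmem l).1 (h ▸ List.getElem_mem hq), ?_⟩
  have hpw := List.pairwise_iff_getElem.1 hs.pairwise
  have hf : (κ.filter fun m => l < m) = (L.take q).toFinset := by
    ext m
    rw [Finset.mem_filter, List.mem_toFinset, List.mem_take_iff_getElem]
    constructor
    · rintro ⟨hm, hlm⟩
      obtain ⟨i, hi, rfl⟩ := List.mem_iff_getElem.1 ((hmem m).2 hm)
      refine ⟨i, lt_min ?_ hi, rfl⟩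
      by_contra hiq
      rcases (not_lt.1 hiq).eq_or_lt with rfl | hlt
      · omega
      · have := hpw q i hq hi hlt
        omega
    · rintro ⟨i, hi, rfl⟩
      have hi' := lt_min_iff.1 hi
      refine ⟨(hmem _).1 (List.getElem_mem hi'.2), ?_⟩
      have := hpw i q hi'.2 hq hi'.1
      omega
  rw [hf, List.toFinset_card_of_nodup ((κ.sort_nodup _).sublist (List.take_sublist _ _)),
    List.length_take, min_eq_left hq.le]

theorem filter_union_eq {κ : Finset ℕ} {l : ℕ} (hl : l ∈ κ) :
    κ = (κ.filter fun m => l < m) ∪ insert l (κ.filter fun m => m < l) := by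
  ext m
  simp only [Finset.mem_union, Finset.mem_filter, Finset.mem_insert]
  constructor
  · intro hm
    rcases lt_trichotomy m l with h | h | h <;> tauto
  · rintro (h | rfl | h) <;> tauto

theorem prod_eq_prod_filter_mul {κ : Finset ℕ} {l : ℕ} (hl : l ∈ κ) (f : ℕ → ℝ) :
    ∏ m ∈ κ, f m = (∏ m ∈ κ.filter fun m => l < m, f m) *
      (f l * ∏ m ∈ κ.filter fun m => m < l, f m) := by
  conv_lhs => rw [filter_union_eq hl]
  rw [Finset.prod_union, Finset.prod_insert (by simp)]
  rw [Finset.disjoint_left]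
  intro m h1 h2
  simp only [Finset.mem_filter, Finset.mem_insert] at h1 h2
  omega

end Bits

/-! ### Summation over the high bits. -/

section ScaleSum

/-- The slack `4 ^ (-R)` makes the induction close: with `x = 4 ^ (-(R + 1))` one has `(2 - 4 * x) *
(1 + x) ≤ 2 - x`. -/
theorem prod_one_add_le_two (l R : ℕ) :
    ∏ m ∈ Finset.Ioc l (l + R), (1 + ((4 : ℝ) ^ (m - l))⁻¹) ≤ 2 - ((4 : ℝ) ^ R)⁻¹ := by
  induction R with
  | zero => simp; norm_num
  | succ R ih =>
    rw [← add_assoc, Finset.prod_Ioc_succ_top (by omega), show l + R + 1 - l = R + 1 by omega]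
    have h4 : (0 : ℝ) < ((4 : ℝ) ^ (R + 1))⁻¹ := by positivity
    have e : ((4 : ℝ) ^ R)⁻¹ = 4 * ((4 : ℝ) ^ (R + 1))⁻¹ := by rw [pow_succ, mul_inv]; ring
    refine (mul_le_mul_of_nonneg_right ih (by positivity)).trans ?_
    rw [e]
    nlinarith

/-- Each of the `q` bits gives up a factor `4 ^ (-l)`. What remains is part of the expansion of `∏
(1 + 4 ^ (-i))`, so dropping the cardinality restriction costs only the constant `2`, independent of
`q` and `R`. -/
theorem sum_powersetCard_sq_prod_le (q l R : ℕ) :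
    ∑ T ∈ (Finset.Ioc l (l + R)).powersetCard q, (∏ m ∈ T, ((2 : ℝ) ^ m)⁻¹) ^ 2 ≤
      2 * (((4 : ℝ) ^ l)⁻¹) ^ q := by
  have h1 : ∀ T ∈ (Finset.Ioc l (l + R)).powersetCard q, (∏ m ∈ T, ((2 : ℝ) ^ m)⁻¹) ^ 2 =
      (((4 : ℝ) ^ l)⁻¹) ^ q * ∏ m ∈ T, ((4 : ℝ) ^ (m - l))⁻¹ := by
    intro T hT
    rw [Finset.mem_powersetCard] at hT
    rw [← Finset.prod_pow, ← hT.2, ← Finset.prod_const, ← Finset.prod_mul_distrib]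
    refine Finset.prod_congr rfl fun m hm => ?_
    have hm' := Finset.mem_Ioc.1 (hT.1 hm)
    rw [← mul_inv, ← pow_add, Nat.add_sub_cancel' hm'.1.le, inv_pow, ← pow_mul, mul_comm m 2,
      pow_mul]
    norm_num
  rw [Finset.sum_congr rfl h1, ← Finset.mul_sum, mul_comm]
  refine mul_le_mul_of_nonneg_right ?_ (by positivity)
  calc ∑ T ∈ (Finset.Ioc l (l + R)).powersetCard q, ∏ m ∈ T, ((4 : ℝ) ^ (m - l))⁻¹
      ≤ ∑ T ∈ (Finset.Ioc l (l + R)).powerset, ∏ m ∈ T, ((4 : ℝ) ^ (m - l))⁻¹ :=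
        Finset.sum_le_sum_of_subset_of_nonneg
          (fun T hT => Finset.mem_powerset.2 (Finset.mem_powersetCard.1 hT).1)
          fun T _ _ => Finset.prod_nonneg fun m _ => by positivity
    _ = ∏ m ∈ Finset.Ioc l (l + R), (1 + ((4 : ℝ) ^ (m - l))⁻¹) :=
        (Finset.prod_one_add _).symm
    _ ≤ 2 := (prod_one_add_le_two l R).trans (by
        have : (0 : ℝ) < ((4 : ℝ) ^ R)⁻¹ := by positivity
        linarith)

end ScaleSum

/-! ### Walsh functions in terms of high bits, pivot and low bits. -/

section Univariate

/-- The univariate Walsh function whose nonzero bits are the position `l`, the elements of `T` and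
those of `S`. -/
noncomputable def bitWal (T : Finset ℕ) (l : ℕ) (S : Finset ℕ) (x : ℝ) : ℝ :=
  (∏ m ∈ T, rad m x) * (rad l x * ∏ m ∈ S, rad m x)

theorem wal_eq_bitWal {k l : ℕ} (hl : l ∈ nonzeroBits k) :
    wal k = bitWal ((nonzeroBits k).filter fun m => l < m) l
      ((nonzeroBits k).filter fun m => m < l) := by
  funext x
  rw [wal_eq_prod_rad, prod_eq_prod_filter_mul hl, bitWal]

theorem bddMeasUnit_bitWal (T : Finset ℕ) (l : ℕ) (S : Finset ℕ) : BddMeasUnit (bitWal T l S) := by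
  refine ⟨(Finset.measurable_prod _ fun m _ => measurable_rad m).mul
    ((measurable_rad l).mul (Finset.measurable_prod _ fun m _ => measurable_rad m)), 1,
    fun t _ => ?_⟩
  simp [bitWal, abs_mul, Finset.abs_prod, abs_rad]

/-- The pivot `n + 1` and the bits of `S` together form the locally constant factor at scale `n +
1`. -/
theorem vanishingPrimitives_bitWal {n : ℕ} {T S : Finset ℕ} (hT : ∀ m ∈ T, n + 1 < m)
    (hS : ∀ m ∈ S, m ≤ n) : VanishingPrimitives T.card (bitWal T (n + 1) S) := by
  obtain ⟨φ, hφ, h⟩ := exists_iterate_primitive_prod_rad T (n + 1) hT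
  exact ⟨bddMeasUnit_bitWal _ _ _, (h _ ((dyadicConst_rad (n + 1)).mul
    ((dyadicConst_prod_rad hS).mono n.le_succ))).2⟩

/-- The kernels that express the fractional integrals of the iterated primitives of the Walsh
functions by their values on dyadic intervals. -/
theorem exists_kernel {lam : ℝ} (h0 : 0 < lam) (h1 : lam ≤ 1) {n : ℕ} {T : Finset ℕ}
    (hT : ∀ m ∈ T, n + 1 < m) : ∃ K : ℕ → ℝ → ℝ, (∀ c, Measurable (K c)) ∧
      (∀ t ∈ Icc (0 : ℝ) 1, ∑ c ∈ Finset.range (2 ^ n), |K c t| ≤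
        kernelConst lam * ((∏ m ∈ T, ((2 : ℝ) ^ m)⁻¹) * (((2 : ℝ) ^ (n + 1))⁻¹ ^ lam / lam))) ∧
      (∀ c < 2 ^ n, ∫ t, |K c t| ∂unitMeasure ≤ ((2 : ℝ) ^ n)⁻¹ *
        (kernelConst lam * ((∏ m ∈ T, ((2 : ℝ) ^ m)⁻¹) * (((2 : ℝ) ^ (n + 1))⁻¹ ^ lam / lam)))) ∧
      ∀ S : Finset ℕ, (∀ m ∈ S, m ≤ n) →
        ∫ x, primitive^[T.card] (bitWal T (n + 1) S) x ∂unitMeasure = 0 ∧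
        ∀ t, ∫ x, fracKernel lam x t * primitive^[T.card] (bitWal T (n + 1) S) x ∂unitMeasure =
          ∑ c ∈ Finset.range (2 ^ n), (∏ m ∈ S, rad m (c * ((2 : ℝ) ^ n)⁻¹)) * K c t := by
  obtain ⟨φ, hφ, h⟩ := exists_iterate_primitive_prod_rad T (n + 1) hT
  set δ : ℝ := ((2 : ℝ) ^ (n + 1))⁻¹ with hδ
  have hδ0 : 0 < δ := by positivity
  have h2δ : ((2 : ℝ) ^ n)⁻¹ = 2 * δ := by rw [hδ, pow_succ, mul_inv]; ring
  have hint : ∀ F : ℝ → ℝ, ∫ x, F x ∂unitMeasure = ∫ x in (0 : ℝ)..1, F x := fun F => by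
    rw [unitMeasure, integral_Icc_eq_integral_Ioc, intervalIntegral.integral_of_le zero_le_one]
  refine ⟨fun c t => diffKernel lam δ φ (c * (2 * δ) - t),
    fun c => (measurable_diffKernel lam δ hφ.measurable).comp (measurable_const.sub measurable_id),
    fun t ht => sum_abs_diffKernel_le hφ.nonnegBdd h0 h1 hδ0 ht.1 _, fun c hc => ?_,
    fun S hS => ?_⟩
  · rw [hint, h2δ]
    refine integral_abs_diffKernel_le hφ.nonnegBdd h0 h1 hδ0 (N := 2 ^ n) ?_ hc
    rw [← h2δ]
    push_cast
    exact mul_inv_cancel₀ (by positivity)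
  · have hχ := dyadicConst_prod_rad hS
    have hprim := (h _ ((dyadicConst_rad (n + 1)).mul (hχ.mono n.le_succ))).1
    have hcongr : ∀ F : ℝ → ℝ, ∫ x in (0 : ℝ)..1, F x * primitive^[T.card] (bitWal T (n + 1) S) x =
        ∫ x in (0 : ℝ)..1, F x * (φ x * (rad (n + 1) x * ∏ m ∈ S, rad m x)) := by
      intro F
      refine intervalIntegral.integral_congr fun x hx => ?_
      rw [uIcc_of_le zero_le_one] at hx
      exact congrArg (F x * ·) (hprim x hx.1)
    refine ⟨?_, fun t => ?_⟩
    · have e := hcongr fun _ => 1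
      simp only [one_mul] at e
      -- The pivot bit supplies one vanishing primitive beyond those of `T`, which is the mean-zero
      -- property.
      have e2 := primitive_mul_rad_mul hφ hχ zero_le_one
      have e3 := primitive_mul_rad_nat hφ (2 ^ n)
      push_cast at e3
      rw [mul_inv_cancel₀ (by positivity)] at e3
      rw [e3, zero_mul] at e2
      rw [hint, e]
      exact e2
    · rw [hint, hcongr]
      exact integral_fracKernel_mul hφ h0 hχ t

end Univariate

/-! ### Square sums of coefficients for fixed high bits. -/

section Coefficients

variable {s α : ℕ} {lam : ℝ} {p : ENNReal}

/-- Coefficients with respect to products of functions with vanishing primitives, in terms of the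
highest fractional derivative of the mixed derivative. -/
theorem integral_mul_prod_eq (h0 : 0 < lam) (h1 : lam ≤ 1) (hp : ENNReal.ofReal lam⁻¹ < p)
    {f g : (Fin s → ℝ) → ℝ} (hf : BddMeas f) (hfg : IsMixedDeriv (fun _ => α) f g)
    {E : Finset (Fin s) → (Fin s → ℝ) → ℝ} (hm : ∀ u, Measurable (E u))
    (hE : ∀ u, MemLp (E u) p (cubeMeasure (Fin s)))
    (hg : ∀ x ∈ cube (Fin s), g x = ∑ u : Finset (Fin s), ((Real.Gamma lam) ^ u.card)⁻¹ *
      ∫ t, E u t * prodKernel lam u x t ∂cubeMeasure (Fin s))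
    {w : Fin s → ℝ → ℝ} (hw : ∀ j, VanishingPrimitives α (w j))
    (hw0 : ∀ j, ∫ x, primitive^[α] (w j) x ∂unitMeasure = 0) :
    ∫ x, f x * ∏ j, w j (x j) ∂cubeMeasure (Fin s) =
      ((-1) ^ α) ^ s * (((Real.Gamma lam) ^ s)⁻¹ * ∫ t, E Finset.univ t *
        ∏ j, ∫ x, fracKernel lam x (t j) * primitive^[α] (w j) x ∂unitMeasure
          ∂cubeMeasure (Fin s)) := by
  have hfrac := fun u => bddMeas_fracIntegral h0 h1 hp (hm u) (hE u) u
  set G : (Fin s → ℝ) → ℝ := fun x => ∑ u : Finset (Fin s),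
    ((Real.Gamma lam) ^ u.card)⁻¹ * fracIntegral lam (E u) u x with hG
  have hterm : ∀ u : Finset (Fin s), BddMeas fun x =>
      ((Real.Gamma lam) ^ u.card)⁻¹ * fracIntegral lam (E u) u x := fun u =>
    BddMeas.mul (f := fun _ => ((Real.Gamma lam) ^ u.card)⁻¹)
      ⟨measurable_const, _, fun _ _ => le_rfl⟩ (hfrac u)
  have hGb : BddMeas G := BddMeas.sum _ fun u _ => hterm u
  have hψ : ∀ j, BddMeasUnit (primitive^[α] (w j)) := fun j => (hw j).1.iterate_primitive α
  have hfG : IsIterPartialDeriv ((List.finRange s).flatMap fun j => List.replicate α j) f G :=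
    IsIterPartialDeriv.congr_right hfg hg
  rw [integral_mul_prod_of_isIterPartialDeriv (List.nodup_finRange s) hf hGb hfG hw,
    List.length_finRange]
  congr 1
  simp only [List.mem_finRange, if_true]
  calc ∫ x, G x * ∏ j, primitive^[α] (w j) (x j) ∂cubeMeasure (Fin s)
      = ∑ u : Finset (Fin s), ((Real.Gamma lam) ^ u.card)⁻¹ *
          ∫ x, fracIntegral lam (E u) u x * ∏ j, primitive^[α] (w j) (x j)
            ∂cubeMeasure (Fin s) := by
        simp only [hG, Finset.sum_mul]
        rw [integral_finsetSum _ fun u _ => ((hterm u).mul (BddMeas.prod_comp hψ)).integrable]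
        simp only [mul_assoc, integral_const_mul]
    _ = ((Real.Gamma lam) ^ s)⁻¹ * ∫ x, fracIntegral lam (E Finset.univ) Finset.univ x *
          ∏ j, primitive^[α] (w j) (x j) ∂cubeMeasure (Fin s) := by
        rw [Finset.sum_eq_single Finset.univ, Finset.card_univ, Fintype.card_fin]
        · intro u _ hu
          rw [integral_fracIntegral_mul_eq_zero h0 h1 hp (hm u) (hE u) hu hψ hw0, mul_zero]
        · exact fun h => absurd (Finset.mem_univ _) h
    _ = _ := by
        rw [integral_fracIntegral_mul h0 h1 hp (hm _) (hE _) _ hψ]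
        simp only [Finset.mem_univ, if_true]

/-- The sum of the squared coefficients over all choices of the bits below the positions
`n j + 1`. -/
theorem sum_sq_integral_bitWal_le (h0 : 0 < lam) (h1 : lam ≤ 1) (hp2 : 2 ≤ p)
    (hp : ENNReal.ofReal lam⁻¹ < p)
    {f g : (Fin s → ℝ) → ℝ} (hf : BddMeas f) (hfg : IsMixedDeriv (fun _ => α) f g)
    {E : Finset (Fin s) → (Fin s → ℝ) → ℝ} (hm : ∀ u, Measurable (E u))
    (hE : ∀ u, MemLp (E u) p (cubeMeasure (Fin s)))
    (hg : ∀ x ∈ cube (Fin s), g x = ∑ u : Finset (Fin s), ((Real.Gamma lam) ^ u.card)⁻¹ *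
      ∫ t, E u t * prodKernel lam u x t ∂cubeMeasure (Fin s))
    (n : Fin s → ℕ) (T : Fin s → Finset ℕ) (hTc : ∀ j, (T j).card = α)
    (hT : ∀ j, ∀ m ∈ T j, n j + 1 < m) :
    ∑ S ∈ Fintype.piFinset fun j => (Finset.Icc 1 (n j)).powerset,
      (∫ x, f x * ∏ j, bitWal (T j) (n j + 1) (S j) (x j) ∂cubeMeasure (Fin s)) ^ 2 ≤
      (((Real.Gamma lam) ^ s)⁻¹) ^ 2 * ((∏ j, (kernelConst lam * ((∏ m ∈ T j, ((2 : ℝ) ^ m)⁻¹) *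
        (((2 : ℝ) ^ (n j + 1))⁻¹ ^ lam / lam))) ^ 2) *
        ∫ t, E Finset.univ t ^ 2 ∂cubeMeasure (Fin s)) := by
  choose K hKm hKsum hKint hK using fun j => exists_kernel h0 h1 (hT j)
  set a : Fin s → ℝ := fun j => kernelConst lam * ((∏ m ∈ T j, ((2 : ℝ) ^ m)⁻¹) *
    (((2 : ℝ) ^ (n j + 1))⁻¹ ^ lam / lam)) with ha
  have ha0 : ∀ j, 0 ≤ a j := fun j => mul_nonneg
    (zero_le_one.trans (one_le_kernelConst lam)) (by positivity)
  have hE2 : MemLp (E Finset.univ) 2 (cubeMeasure (Fin s)) := (hE _).mono_exponent hp2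
  have hEi : Integrable (E Finset.univ) (cubeMeasure (Fin s)) := hE2.integrable (by norm_num)
  set A : (Fin s → ℕ) → ℝ := fun c =>
    ∫ t, E Finset.univ t * ∏ j, K j (c j) (t j) ∂cubeMeasure (Fin s) with hA
  have hcoeff : ∀ S ∈ Fintype.piFinset fun j => (Finset.Icc 1 (n j)).powerset,
      (∫ x, f x * ∏ j, bitWal (T j) (n j + 1) (S j) (x j) ∂cubeMeasure (Fin s)) ^ 2 =
      (((Real.Gamma lam) ^ s)⁻¹) ^ 2 *
        (∑ c ∈ Fintype.piFinset fun j => Finset.range (2 ^ n j),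
          (∏ j, ∏ m ∈ S j, rad m (c j * ((2 : ℝ) ^ n j)⁻¹)) * A c) ^ 2 := by
    intro S hS
    have hS' : ∀ j, ∀ m ∈ S j, m ≤ n j := fun j m hm' =>
      (Finset.mem_Icc.1 (Finset.mem_powerset.1 (Fintype.mem_piFinset.1 hS j) hm')).2
    have hint : ∫ t, E Finset.univ t * ∏ j, ∫ x, fracKernel lam x (t j) *
        primitive^[α] (bitWal (T j) (n j + 1) (S j)) x ∂unitMeasure ∂cubeMeasure (Fin s) =
        ∑ c ∈ Fintype.piFinset fun j => Finset.range (2 ^ n j),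
          (∏ j, ∏ m ∈ S j, rad m (c j * ((2 : ℝ) ^ n j)⁻¹)) * A c := by
      have e : ∀ t : Fin s → ℝ, E Finset.univ t * ∏ j, ∫ x, fracKernel lam x (t j) *
          primitive^[α] (bitWal (T j) (n j + 1) (S j)) x ∂unitMeasure =
          ∑ c ∈ Fintype.piFinset fun j => Finset.range (2 ^ n j),
            (∏ j, ∏ m ∈ S j, rad m (c j * ((2 : ℝ) ^ n j)⁻¹)) *
              (E Finset.univ t * ∏ j, K j (c j) (t j)) := by
        intro t
        have e1 : ∀ j, ∫ x, fracKernel lam x (t j) *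
            primitive^[α] (bitWal (T j) (n j + 1) (S j)) x ∂unitMeasure =
            ∑ c ∈ Finset.range (2 ^ n j), (∏ m ∈ S j, rad m (c * ((2 : ℝ) ^ n j)⁻¹)) *
              K j c (t j) := by
          intro j
          rw [← (hK j (S j) (hS' j)).2 (t j), hTc j]
        simp only [e1]
        rw [Finset.prod_univ_sum, Finset.mul_sum]
        refine Finset.sum_congr rfl fun c _ => ?_
        rw [Finset.prod_mul_distrib]
        ring
      simp only [e]
      rw [integral_finsetSum]
      · simp only [integral_const_mul, hA]
      · intro c hc
        refine Integrable.const_mul ?_ _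
        obtain ⟨hkm, M, hM⟩ := BddMeas.prod_comp (w := fun j => K j (c j)) fun j =>
          ⟨hKm j (c j), a j, fun t ht => (Finset.single_le_sum (f := fun c => |K j c t|)
            (fun _ _ => abs_nonneg _) (Fintype.mem_piFinset.1 hc j)).trans (hKsum j t ht)⟩
        exact hEi.mul_bdd (c := M) hkm.aestronglyMeasurable (ae_mem_cube.mono hM)
    rw [integral_mul_prod_eq h0 h1 hp hf hfg hm hE hg
      (w := fun j => bitWal (T j) (n j + 1) (S j))
      (fun j => by rw [← hTc j]; exact vanishingPrimitives_bitWal (hT j) (hS' j))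
      (fun j => by
        have := (hK j (S j) (hS' j)).1
        rwa [hTc j] at this), hint, mul_pow, mul_pow, ← pow_mul, ← pow_mul,
      Even.neg_one_pow (by simp), one_mul]
  rw [Finset.sum_congr rfl hcoeff, ← Finset.mul_sum, sum_sq_discreteWalsh]
  refine mul_le_mul_of_nonneg_left ?_ (sq_nonneg _)
  have hschur := sum_sq_integral_prod_kernel_le hE2 (fun j => 2 ^ n j) hKm hKsum
    (b := fun j => ((2 : ℝ) ^ n j)⁻¹ * a j) (fun j => mul_nonneg (by positivity) (ha0 j)) hKint
  refine (mul_le_mul_of_nonneg_left hschur (Finset.prod_nonneg fun j _ => by positivity)).trans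
    (le_of_eq ?_)
  rw [← mul_assoc, ← mul_assoc, ← Finset.prod_mul_distrib, ← Finset.prod_mul_distrib]
  congr 1
  refine Finset.prod_congr rfl fun j _ => ?_
  -- The factor `2 ^ n` from the discrete Parseval identity cancels the cell length in the column
  -- bound.
  have : (2 : ℝ) ^ n j * ((2 : ℝ) ^ n j)⁻¹ = 1 := mul_inv_cancel₀ (by positivity)
  linear_combination (a j) ^ 2 * this

theorem fracConst_nonneg (h0 : 0 < lam) : 0 ≤ fracConst lam := by
  have := Real.Gamma_pos_of_pos (by linarith : 0 < lam + 1)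
  unfold fracConst
  split_ifs <;> positivity

/-- The `2` comes from summing over the high bits, `kernelConst` from the row and column bounds, and
the denominator from `Gamma (lam + 1) = lam * Gamma lam`. -/
theorem fracConst_sq (h0 : 0 < lam) (h1 : lam ≤ 1) :
    fracConst lam ^ 2 = 2 * (kernelConst lam / (Real.Gamma lam * lam)) ^ 2 := by
  rcases h1.lt_or_eq with h | rfl
  · rw [fracConst, if_pos h, kernelConst, if_pos h, Real.Gamma_add_one h0.ne', div_pow, mul_pow,
      Real.sq_sqrt zero_le_two]
    ring
  · simp [fracConst, kernelConst]

theorem toReal_eLpNorm_two_sq {X : Type*} [MeasurableSpace X] {μ : Measure X} {F : X → ℝ}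
    (hF : MemLp F 2 μ) : (eLpNorm F 2 μ).toReal ^ 2 = ∫ x, F x ^ 2 ∂μ := by
  rw [hF.eLpNorm_eq_integral_rpow_norm two_ne_zero ENNReal.ofNat_ne_top, ENNReal.toReal_ofReal
    (by positivity)]
  have h2 : (2 : ENNReal).toReal = 2 := by simp
  have hnn : 0 ≤ ∫ x, F x ^ 2 ∂μ := integral_nonneg fun x => sq_nonneg _
  simp only [h2, Real.rpow_ofNat, Real.norm_eq_abs, sq_abs]
  rw [← Real.sqrt_sq hnn, ← Real.rpow_natCast, ← Real.rpow_mul (by positivity)]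
  norm_num

end Coefficients

/-! ### Summation over a whole block. -/

section Block

variable {s α : ℕ}

/-- The nonzero bits of a frequency in a block that are beyond the position defining the block. -/
def highBits (l k : Fin s → ℕ) (j : Fin s) : Finset ℕ :=
  (nonzeroBits (k j)).filter fun m => l j < m

/-- The nonzero bits of a frequency in a block that precede the position defining the block. -/
def lowBits (l k : Fin s → ℕ) (j : Fin s) : Finset ℕ :=
  (nonzeroBits (k j)).filter fun m => m < l j

theorem mem_nonzeroBits_of_mem_block {l k : Fin s → ℕ} (hk : k ∈ block α l) (hl : ∀ j, 1 ≤ l j)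
    (j : Fin s) : l j ∈ nonzeroBits (k j) := (qthLargest_spec (hk.2 j) (hl j)).1

theorem card_highBits {l k : Fin s → ℕ} (hk : k ∈ block α l) (hl : ∀ j, 1 ≤ l j) (j : Fin s) :
    (highBits l k j).card = α := (qthLargest_spec (hk.2 j) (hl j)).2

theorem injOn_bits {l : Fin s → ℕ} (hl : ∀ j, 1 ≤ l j) :
    Set.InjOn (fun k => (highBits l k, lowBits l k)) (block α l) := by
  intro k hk k' hk' h
  rw [Prod.mk.injEq] at h
  funext j
  refine nonzeroBits_injective ?_
  rw [filter_union_eq (mem_nonzeroBits_of_mem_block hk hl j),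
    filter_union_eq (mem_nonzeroBits_of_mem_block hk' hl j)]
  have h1 := congrFun h.1 j
  have h2 := congrFun h.2 j
  rw [highBits, highBits] at h1
  rw [lowBits, lowBits] at h2
  rw [h1, h2]

theorem walshCoeff_eq_integral_bitWal {l k : Fin s → ℕ} (hk : k ∈ block α l) (hl : ∀ j, 1 ≤ l j)
    (f : (Fin s → ℝ) → ℝ) : walshCoeff f k = ∫ x, (cube (Fin s)).indicator f x *
      ∏ j, bitWal (highBits l k j) (l j) (lowBits l k j) (x j) ∂cubeMeasure (Fin s) := by
  rw [walshCoeff, volume_restrict_cube]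
  refine integral_congr_ae (ae_mem_cube.mono fun x hx => ?_)
  simp only
  rw [Set.indicator_of_mem hx]
  congr 1
  exact Finset.prod_congr rfl fun j _ => by
    rw [wal_eq_bitWal (mem_nonzeroBits_of_mem_block hk hl j)]; rfl

/-- Nothing is known of `f` off the cube, while `BddMeas` asks for measurability everywhere;
extension by zero changes no coefficient. -/
theorem bddMeas_indicator_of_continuousOn {f : (Fin s → ℝ) → ℝ}
    (hf : ContinuousOn f (cube (Fin s))) : BddMeas ((cube (Fin s)).indicator f) := by
  have hc : IsCompact (cube (Fin s)) := by
    rw [cube_eq_pi]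
    exact isCompact_univ_pi fun _ => isCompact_Icc
  obtain ⟨M, hM⟩ := hc.exists_bound_of_continuousOn hf
  classical
  refine ⟨?_, M, fun x hx => ?_⟩
  · have := hf.measurable_piecewise (g := 0) continuousOn_const measurableSet_cube
    rwa [Set.piecewise_eq_indicator] at this
  · rw [Set.indicator_of_mem hx]
    exact hM x hx

/-- A finite sum over a block is dominated by the sum over all choices of high and low bits. -/
theorem sum_block_le {l : Fin s → ℕ} (hl : ∀ j, 1 ≤ l j) (F : Finset (block α l))
    {co : (Fin s → Finset ℕ) → (Fin s → Finset ℕ) → ℝ} (hco : ∀ T S, 0 ≤ co T S) :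
    ∃ R : ℕ, ∑ k ∈ F, co (highBits l k) (lowBits l k) ≤
      ∑ T ∈ Fintype.piFinset fun j => (Finset.Ioc (l j) (l j + R)).powersetCard α,
        ∑ S ∈ Fintype.piFinset fun j => (Finset.Icc 1 (l j - 1)).powerset, co T S := by
  classical
  -- Any common bound for the bit lengths occurring in `F` would serve, since the later estimate is
  -- uniform in `R`.
  refine ⟨∑ k ∈ F, ∑ j, (k.1 j).size, ?_⟩
  rw [← Finset.sum_product', ← Finset.sum_image (s := F)
    (g := fun k : block α l => (highBits l k, lowBits l k))
    (f := fun q : (Fin s → Finset ℕ) × (Fin s → Finset ℕ) => co q.1 q.2)]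
  · refine Finset.sum_le_sum_of_subset_of_nonneg ?_ fun q _ _ => hco _ _
    intro q hq
    obtain ⟨k, hkF, rfl⟩ := Finset.mem_image.1 hq
    rw [Finset.mem_product, Fintype.mem_piFinset, Fintype.mem_piFinset]
    refine ⟨fun j => Finset.mem_powersetCard.2 ⟨fun m hm => ?_, card_highBits k.2 hl j⟩,
      fun j => Finset.mem_powerset.2 fun m hm => ?_⟩
    · have h := Finset.mem_filter.1 hm
      have h1 : m ≤ (k.1 j).size := (Finset.mem_Icc.1 (Finset.mem_filter.1 h.1).1).2
      have h2 : (k.1 j).size ≤ ∑ j, (k.1 j).size :=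
        Finset.single_le_sum (f := fun j => (k.1 j).size) (fun _ _ => Nat.zero_le _)
          (Finset.mem_univ j)
      have h3 : ∑ j, (k.1 j).size ≤ ∑ k ∈ F, ∑ j, (k.1 j).size :=
        Finset.single_le_sum (f := fun k : block α l => ∑ j, (k.1 j).size)
          (fun _ _ => Nat.zero_le _) hkF
      exact Finset.mem_Ioc.2 ⟨h.2, by omega⟩
    · have h := Finset.mem_filter.1 hm
      have h1 := (mem_nonzeroBits.1 h.1).1
      exact Finset.mem_Icc.2 ⟨h1, by have := h.2; omega⟩
  · intro k _ k' _ h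
    exact Subtype.ext (injOn_bits hl k.2 k'.2 h)

theorem sum_walshCoeff_sq_le {lam : ℝ} {p : ENNReal} (h0 : 0 < lam) (h1 : lam ≤ 1) (hp2 : 2 ≤ p)
    (hp : ENNReal.ofReal lam⁻¹ < p) {f g : (Fin s → ℝ) → ℝ} (hf : ContinuousOn f (cube (Fin s)))
    (hfg : IsMixedDeriv (fun _ => α) f g) {D : ∀ u : Finset (Fin s), (u → ℝ) → ℝ}
    (hD : IsFracDeriv lam p g D) {l : Fin s → ℕ} (hl : ∀ j, 1 ≤ l j) (F : Finset (block α l)) :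
    ∑ k ∈ F, |walshCoeff f k| ^ 2 ≤ (fracConst lam ^ s *
        (eLpNorm (D Finset.univ) 2
          (volume.restrict (cube (Finset.univ : Finset (Fin s))))).toReal *
        (2 : ℝ) ^ (-((α : ℝ) + lam) * ((∑ j, l j : ℕ) : ℝ))) ^ 2 := by
  obtain ⟨E, hm, hE, hEn, hg⟩ := hD.exists_cubeMeasure_rep
  obtain ⟨n, rfl⟩ : ∃ n : Fin s → ℕ, l = fun j => n j + 1 :=
    ⟨fun j => l j - 1, funext fun j => (Nat.sub_add_cancel (hl j)).symm⟩
  have hfb := bddMeas_indicator_of_continuousOn hf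
  have hfg' : IsMixedDeriv (fun _ => α) ((cube (Fin s)).indicator f) g :=
    IsIterPartialDeriv.congr_left hfg fun x hx => (Set.indicator_of_mem hx f).symm
  have hE2 : MemLp (E Finset.univ) 2 (cubeMeasure (Fin s)) := (hE _).mono_exponent hp2
  rw [← hEn, mul_pow, mul_pow, toReal_eLpNorm_two_sq hE2]
  set I := ∫ t, E Finset.univ t ^ 2 ∂cubeMeasure (Fin s) with hI
  have hI0 : 0 ≤ I := integral_nonneg fun t => sq_nonneg _
  obtain ⟨R, hR⟩ := sum_block_le hl F (co := fun T S => (∫ x, (cube (Fin s)).indicator f x *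
      ∏ j, bitWal (T j) (n j + 1) (S j) (x j) ∂cubeMeasure (Fin s)) ^ 2) fun _ _ => sq_nonneg _
  set b : Fin s → ℝ := fun j => ((2 : ℝ) ^ (n j + 1))⁻¹ ^ lam / lam with hb
  set A := kernelConst lam with hA
  calc ∑ k ∈ F, |walshCoeff f k| ^ 2
      = ∑ k ∈ F, (∫ x, (cube (Fin s)).indicator f x * ∏ j,
          bitWal (highBits (fun j => n j + 1) k j) (n j + 1) (lowBits (fun j => n j + 1) k j) (x j)
            ∂cubeMeasure (Fin s)) ^ 2 := by
        refine Finset.sum_congr rfl fun k _ => ?_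
        rw [sq_abs, walshCoeff_eq_integral_bitWal k.2 hl]
    _ ≤ _ := hR
    _ ≤ ∑ T ∈ Fintype.piFinset fun j => (Finset.Ioc (n j + 1) (n j + 1 + R)).powersetCard α,
          (((Real.Gamma lam) ^ s)⁻¹) ^ 2 *
            ((∏ j, (A * ((∏ m ∈ T j, ((2 : ℝ) ^ m)⁻¹) * b j)) ^ 2) * I) := by
        -- With the high bits `T` fixed, the inner sum over low bits is handled by Parseval and
        -- Schur.
        refine Finset.sum_le_sum fun T hT => ?_
        have hT' := fun j => Finset.mem_powersetCard.1 (Fintype.mem_piFinset.1 hT j)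
        exact sum_sq_integral_bitWal_le h0 h1 hp2 hp hfb hfg' hm hE hg n T (fun j => (hT' j).2)
          fun j m hm' => (Finset.mem_Ioc.1 ((hT' j).1 hm')).1
    _ = (((Real.Gamma lam) ^ s)⁻¹) ^ 2 * ((∏ j, (A * b j) ^ 2 *
          ∑ T ∈ (Finset.Ioc (n j + 1) (n j + 1 + R)).powersetCard α,
            (∏ m ∈ T, ((2 : ℝ) ^ m)⁻¹) ^ 2) * I) := by
        rw [← Finset.mul_sum, ← Finset.sum_mul]
        simp only [Finset.mul_sum]
        rw [Finset.prod_univ_sum]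
        congr 2
        refine Finset.sum_congr rfl fun T _ => Finset.prod_congr rfl fun j _ => ?_
        ring
    _ ≤ (((Real.Gamma lam) ^ s)⁻¹) ^ 2 * ((∏ j, (A * b j) ^ 2 *
          (2 * (((4 : ℝ) ^ (n j + 1))⁻¹) ^ α)) * I) := by
        refine mul_le_mul_of_nonneg_left (mul_le_mul_of_nonneg_right ?_ hI0) (sq_nonneg _)
        refine Finset.prod_le_prod (fun j _ => mul_nonneg (sq_nonneg _)
          (Finset.sum_nonneg fun T _ => sq_nonneg _)) fun j _ => ?_
        exact mul_le_mul_of_nonneg_left (sum_powersetCard_sq_prod_le α _ R) (sq_nonneg _)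
    _ = (fracConst lam ^ s) ^ 2 * I *
          ((2 : ℝ) ^ (-((α : ℝ) + lam) * ((∑ j, (n j + 1) : ℕ) : ℝ))) ^ 2 := by
        have e1 : (2 : ℝ) ^ (-((α : ℝ) + lam) * ((∑ j, (n j + 1) : ℕ) : ℝ)) =
            ∏ j, (2 : ℝ) ^ (-((α : ℝ) + lam) * ((n j + 1 : ℕ) : ℝ)) := by
          rw [← Real.rpow_sum_of_pos two_pos, ← Finset.mul_sum, Nat.cast_sum]
        -- Per coordinate: `A * b j` carries the decay `2 ^ (-lam * l j)`, and the sum over high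
        -- bits the decay `4 ^ (-α * l j)` with its factor `2`.
        have e2 : ∀ j, (A * b j) ^ 2 * (2 * (((4 : ℝ) ^ (n j + 1))⁻¹) ^ α) =
            Real.Gamma lam ^ 2 * (fracConst lam ^ 2 *
              ((2 : ℝ) ^ (-((α : ℝ) + lam) * ((n j + 1 : ℕ) : ℝ))) ^ 2) := by
          intro j
          have hΓ := (Real.Gamma_pos_of_pos h0).ne'
          have e3 : ((2 : ℝ) ^ (-((α : ℝ) + lam) * ((n j + 1 : ℕ) : ℝ))) =
              (((2 : ℝ) ^ (n j + 1))⁻¹) ^ α * ((2 : ℝ) ^ (n j + 1))⁻¹ ^ lam := by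
            have e4 : ((2 : ℝ) ^ (n j + 1))⁻¹ = (2 : ℝ) ^ (-((n j + 1 : ℕ) : ℝ)) := by
              rw [Real.rpow_neg zero_le_two, Real.rpow_natCast]
            rw [e4, ← Real.rpow_natCast, ← Real.rpow_mul zero_le_two, ← Real.rpow_mul zero_le_two,
              ← Real.rpow_add two_pos]
            congr 1
            ring
          have e5 : (((4 : ℝ) ^ (n j + 1))⁻¹) ^ α = ((((2 : ℝ) ^ (n j + 1))⁻¹) ^ α) ^ 2 := by
            rw [pow_right_comm _ α, inv_pow (2 ^ (n j + 1) : ℝ) 2, pow_right_comm (2 : ℝ)]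
            norm_num
          rw [fracConst_sq h0 h1, e3, e5, ← hA]
          simp only [hb]
          field_simp
        simp only [e2]
        rw [Finset.prod_mul_distrib, Finset.prod_mul_distrib, Finset.prod_const, Finset.prod_const,
          Finset.card_univ, Fintype.card_fin, e1, ← Finset.prod_pow]
        have hΓ := (Real.Gamma_pos_of_pos h0).ne'
        field_simp
        ring

end Block

end WalshSobolev

theorem mainTheorem7 (s α : ℕ) (lam : ℝ) (hlam0 : 0 < lam) (hlam1 : lam ≤ 1)
    (p : ENNReal) (hp2 : 2 ≤ p) (hplam : ENNReal.ofReal lam⁻¹ < p)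
    (f g : (Fin s → ℝ) → ℝ)
    (hf : ContinuousOn f (WalshSobolev.cube (Fin s)))
    (hfg : WalshSobolev.IsMixedDeriv (fun _ => α) f g)
    (D : ∀ u : Finset (Fin s), (u → ℝ) → ℝ)
    (hD : WalshSobolev.IsFracDeriv lam p g D)
    (l : Fin s → ℕ) (hl : ∀ j, 1 ≤ l j) :
    Summable (fun k : WalshSobolev.block α l => |WalshSobolev.walshCoeff f k| ^ 2) ∧
    Real.sqrt (∑' k : WalshSobolev.block α l, |WalshSobolev.walshCoeff f k| ^ 2) ≤
      WalshSobolev.fracConst lam ^ s *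
        (MeasureTheory.eLpNorm (D Finset.univ) 2
          (MeasureTheory.volume.restrict
            (WalshSobolev.cube (Finset.univ : Finset (Fin s))))).toReal *
        (2 : ℝ) ^ (-((α : ℝ) + lam) * ((∑ j, l j : ℕ) : ℝ)) := by
  have hsum := WalshSobolev.sum_walshCoeff_sq_le hlam0 hlam1 hp2 hplam hf hfg hD hl
  have hnn : 0 ≤ fun k : WalshSobolev.block α l => |WalshSobolev.walshCoeff f k| ^ 2 :=
    fun k => sq_nonneg _
  -- The bound on finite subsums of a nonnegative family is uniform, so it gives convergence and the
  -- estimate together.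
  refine ⟨summable_of_sum_le hnn hsum, Real.sqrt_le_iff.2 ⟨?_, Real.tsum_le_of_sum_le hnn hsum⟩⟩
  have := WalshSobolev.fracConst_nonneg hlam0
  positivity
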